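/- **Setting.** Let $d\ge 0$, let $p$ be an irreducible translation-invariant transition probability on $\mathbb Z^d$, and let $g^k_{\alpha,\beta}\ge 0$ ($k,\alpha,\beta\in\mathbb N$) satisfy $g^0_{\alpha,\beta}=0$ and $g^k_{\alpha,\beta}=0$ for $k>\alpha$. Let $a_x>0$ ($x\in\mathbb Z^d$) satisfy $\sum_x a_x<\infty$ and, for some constant $M$, $\sum_y p(x,y)a_y+\sum_y a_y p(y,x)\le M a_x$ for all $x$. For $\eta\in\mathbb N^{\mathbb Z^d}$ put $\|\eta\|=\sum_x\eta(x)a_x$, let $\mathfrak X=\{\eta:\|\eta\|<\infty\}$, and write $\|\eta-\zeta\|=\sum_x|\eta(x)-\zeta(x)|a_x$. For $f:\mathbb N^{\mathbb Z^d}\to\mathbb R$ let $$\mathcal L f(\eta)=\sum_{x,y}\sum_{k=1}^{\eta(x)}p(x,y)\,g^k_{\eta(x),\eta(y)}\bigl(f(S^k_{x,y}\eta)-f(\eta)\bigr),$$ where $S^k_{x,y}\eta$ is $\eta$ after moving $k$ particles from $x$ to $y$. A *mass migration process* (MMP) with generator $\mathcal L$ is a Markov process with a measurable state space $\Omega\subseteq\mathbb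 N^{\mathbb Z^d}$ and transition semigroup $S(t)f(\eta)=\mathbb E^\eta f(\eta_t)$ such that $\lim_{t\downarrow0}(S(t)f(\eta)-f(\eta))/t=\mathcal L f(\eta)$ for all $\eta\in\Omega$ and all bounded cylinder functions $f$. A probability measure $\nu$ on $\mathbb N^{\mathbb Z^d}$ is *invariant* if $\nu(\Omega)=1$ and $\int S(t)f\,d\nu=\int f\,d\nu$ for all $t\ge0$ and all bounded measurable $f$ that are Lipschitz on $\Omega$ with respect to $\|\eta-\zeta\|$ (pairs at infinite distance imposing no condition). Consider two sets of assumptions on the MMP. * **(S)** $\Omega=\mathfrak X$; for some $C>0$, $\sum_{k=1}^\alpha k\,g^k_{\alpha,\beta}\le C(\alpha+\beta)$ for all $\alpha>0,\beta\ge0$; and $S(t)$ is a semigroup on the Lipschitz functions on $\mathfrak X$ generated by $\mathcal L$, i.e. every (measurable) Lipschitz $f$ is integrable under the transition probabilities, there is $c>0$ such that $S(t)f$ has Lipschitz constant at most $e^{ct}L_f$ whenever $f$ has Lipschitz constant $L_f$, and $S(t)f(\eta)=f(\eta)+\int_0^t\mathcal L S(s)f(\eta)\,ds$ for $\eta\in\mathfrak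 X$, $t\ge 0$. * **(B)** For some $C>0$, $\sum_{k=1}^{\alpha}g^k_{\alpha,\beta}\le C$ for all $\alpha,\beta\ge0$; and a probability measure $\nu$ on $\mathbb N^{\mathbb Z^d}$ is invariant if and only if $\mathcal L f\in L^1(\nu)$ and $\int\mathcal L f\,d\nu=0$ for every bounded cylinder function $f$. **Statement.** Let $\bar\mu$ be a translation-invariant product probability measure on $\mathbb N^{\mathbb Z^d}$ with single-site marginal $\mu$, invariant for the MMP. Assume that either (S) holds and $\sum_n n\mu(n)<\infty$, or (B) holds. Let $\varphi_c\in[0,\infty]$ be the radius of convergence of $Z_\varphi=\sum_{n\ge0}\varphi^n\mu(n)$, and let $\bar\mu_\varphi$ be the product measure on $\mathbb N^{\mathbb Z^d}$ all of whose single-site marginals are $\mu_\varphi(n)=Z_\varphi^{-1}\varphi^n\mu(n)$. Then: 1. $\varphi_c\ge1$, and for every $0\le\varphi<\varphi_c$ (with $\mu(0)>0$ if $\varphi=0$), $\bar\mu_\varphi$ is an invariant probability measure. 2. If $\varphi_c<\infty$, and either $\sum_n n\varphi_c^n\mu(n)<\infty$, or $Z_{\varphi_c}<\infty$ and (B) holds,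 then $\bar\mu_{\varphi_c}$ is an invariant probability measure. 3. Let $\mathrm{Rad}(Z)$ be $(0,\varphi_c]$ if $\varphi_c<\infty$ and $Z_{\varphi_c}<\infty$, and $(0,\varphi_c)$ otherwise; let $\mathrm{Rad}(Z')$ be $(0,\varphi_c]$ if $\varphi_c<\infty$ and $\sum_n n\varphi_c^n\mu(n)<\infty$, and $(0,\varphi_c)$ otherwise. Then $\mathrm{Rad}(Z')\subseteq\mathrm{Rad}(Z)$; all members of $\{\bar\mu_\varphi:\varphi\in\mathrm{Rad}(Z')\}$ are invariant probability measures, and if (B) holds, so are all members of $\{\bar\mu_\varphi:\varphi\in\mathrm{Rad}(Z)\}$. -/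

import Mathlib

open MeasureTheory ProbabilityTheory Filter Topology
open scoped NNReal ENNReal

noncomputable section

namespace MMP

/-- The sites, i.e. the lattice `ℤ^d`. -/
abbrev Site (d : ℕ) : Type := Fin d → ℤ

/-- Configurations `η`, with `η x` the number of particles at the site `x`; this space carries the
product σ-algebra. -/
abbrev Config (d : ℕ) : Type := Site d → ℕ

/-- `g k α β` is the rate factor `g^k_{α,β}` at which `k` of the `α` particles of the departure site
jump together to a target site occupied by `β` particles. -/
structure IsRate (g : ℕ → ℕ → ℕ → ℝ) : Prop where
  nonneg : ∀ k α β, 0 ≤ g k α β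
  zero : ∀ α β, g 0 α β = 0
  eq_zero_of_lt : ∀ k α β, α < k → g k α β = 0

/-- An irreducible translation invariant transition probability on `ℤ^d`. -/
structure IsTransition {d : ℕ} (p : Site d → Site d → ℝ) : Prop where
  nonneg : ∀ x y, 0 ≤ p x y
  hasSum : ∀ x, HasSum (p x) 1
  translation : ∀ x y z, p (x + z) (y + z) = p x y
  irreducible : ∀ x y, Relation.ReflTransGen (fun u v => 0 < p u v) x y

/-- The positive summable weights `a` that enter the norm `‖η‖ = ∑ x, η x * a x`. (The two series
below converge, because `a` is summable and `p` is bounded by `1`.) -/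
structure IsWeight {d : ℕ} (p : Site d → Site d → ℝ) (a : Site d → ℝ) : Prop where
  pos : ∀ x, 0 < a x
  summable : Summable a
  bound : ∃ M : ℝ, ∀ x, ∑' y, p x y * a y + ∑' y, a y * p y x ≤ M * a x

/-- The space of configurations with `‖η‖ < ∞`. -/
def configSpace {d : ℕ} (a : Site d → ℝ) : Set (Config d) :=
  {η | Summable fun x => (η x : ℝ) * a x}

/-- The condition `∑_{k ≤ α} k g^k_{α,β} ≤ C (α + β)` for all `α > 0`, `β ≥ 0`. -/
def LinearGrowth (g : ℕ → ℕ → ℕ → ℝ) : Prop :=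
  ∃ C : ℝ, 0 < C ∧ ∀ α β : ℕ, 0 < α →
    ∑ k ∈ Finset.Icc 1 α, (k : ℝ) * g k α β ≤ C * ((α : ℝ) + (β : ℝ))

/-- The condition `∑_{k ≤ α} g^k_{α,β} ≤ C` for all `α, β ≥ 0`. -/
def BoundedRates (g : ℕ → ℕ → ℕ → ℝ) : Prop :=
  ∃ C : ℝ, 0 < C ∧ ∀ α β : ℕ, ∑ k ∈ Finset.Icc 1 α, g k α β ≤ C

/-- The configuration after `k` particles have jumped from `x` to `y` (unchanged if there are fewer
than `k` particles at `x`, or if `x = y`). -/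
def jump {d : ℕ} (x y : Site d) (k : ℕ) (η : Config d) : Config d := fun z =>
  if k ≤ η x then (η z - if z = x then k else 0) + (if z = y then k else 0) else η z

/-- The infinitesimal generator
`ℒ f (η) = ∑_{x,y} ∑_{k>0} p(x,y) g^k_{η(x),η(y)} (f(S^k_{x,y} η) - f(η))`. -/
def generator {d : ℕ} (g : ℕ → ℕ → ℕ → ℝ) (p : Site d → Site d → ℝ) (f : Config d → ℝ)
    (η : Config d) : ℝ :=
  ∑' xy : Site d × Site d, ∑ k ∈ Finset.Icc 1 (η xy.1),
    p xy.1 xy.2 * g k (η xy.1) (η xy.2) * (f (jump xy.1 xy.2 k η) - f η)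

/-- Bounded cylinder functions: bounded functions of finitely many coordinates. -/
def IsBoundedCylinder {d : ℕ} (f : Config d → ℝ) : Prop :=
  (∃ m : ℝ, ∀ η, |f η| ≤ m) ∧ ∃ V : Finset (Site d), DependsOn f (V : Set (Site d))

/-- `f` is a (measurable) function that is Lipschitz on `Ω` with constant `K`, for the distance
`‖η - ζ‖ = ∑ x, |η x - ζ x| * a x`. On `Ω = configSpace a` this distance is always finite and
measurability on `Ω` is automatic; in general pairs at infinite distance impose no condition. -/
def IsLipschitz {d : ℕ} (a : Site d → ℝ) (Ω : Set (Config d)) (K : ℝ) (f : Config d → ℝ) : Prop :=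
  Measurable f ∧ 0 ≤ K ∧ ∀ η ∈ Ω, ∀ ζ ∈ Ω,
    (Summable fun x => |(η x : ℝ) - (ζ x : ℝ)| * a x) →
      |f η - f ζ| ≤ K * ∑' x, |(η x : ℝ) - (ζ x : ℝ)| * a x

/-- The semigroup `S(t) f (η) = E^η f(η_t)` of the Markov process with transition kernels `P t`. -/
def semigroup {d : ℕ} (P : ℝ≥0 → Kernel (Config d) (Config d)) (t : ℝ≥0) (f : Config d → ℝ)
    (η : Config d) : ℝ :=
  ∫ ξ, f ξ ∂(P t η)

/-- `P` is the transition semigroup of a Markov process with state space `Ω` and infinitesimal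
generator `ℒ`, the latter on bounded cylinder functions. The values of the kernels outside of `Ω`
are irrelevant. -/
structure IsProcess {d : ℕ} (g : ℕ → ℕ → ℕ → ℝ) (p : Site d → Site d → ℝ) (Ω : Set (Config d))
    (P : ℝ≥0 → Kernel (Config d) (Config d)) : Prop where
  measurableSet : MeasurableSet Ω
  markov : ∀ t, IsMarkovKernel (P t)
  carried : ∀ t, ∀ η ∈ Ω, P t η Ωᶜ = 0
  start : ∀ η ∈ Ω, P 0 η = Measure.dirac η
  chapman : ∀ s t, ∀ η ∈ Ω, P (s + t) η = (P s η).bind (P t)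
  hasGenerator : ∀ f, IsBoundedCylinder f → ∀ η ∈ Ω,
    Tendsto (fun t : ℝ≥0 => (semigroup P t f η - f η) / (t : ℝ)) (𝓝[>] 0)
      (𝓝 (generator g p f η))

/-- The semigroup acts on the Lipschitz functions on `configSpace a`, it increases Lipschitz
constants at most exponentially in time, and it is generated there by `ℒ`:
`S(t) f (η) = f(η) + ∫_0^t ℒ S(s) f (η) ds`. -/
structure GeneratedOnLipschitz {d : ℕ} (g : ℕ → ℕ → ℕ → ℝ) (p : Site d → Site d → ℝ)
    (a : Site d → ℝ) (P : ℝ≥0 → Kernel (Config d) (Config d)) : Prop where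
  integrable : ∀ K f, IsLipschitz a (configSpace a) K f →
    ∀ t, ∀ η ∈ configSpace a, Integrable f (P t η)
  lipschitz : ∃ c : ℝ, 0 < c ∧ ∀ K f, IsLipschitz a (configSpace a) K f →
    ∀ t : ℝ≥0, IsLipschitz a (configSpace a) (K * Real.exp (c * (t : ℝ))) (semigroup P t f)
  backward : ∀ K f, IsLipschitz a (configSpace a) K f → ∀ t : ℝ≥0, ∀ η ∈ configSpace a,
    IntervalIntegrable (fun s : ℝ => generator g p (semigroup P s.toNNReal f) η) volume 0 (t : ℝ) ∧
    semigroup P t f η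
      = f η + ∫ s in (0 : ℝ)..(t : ℝ), generator g p (semigroup P s.toNNReal f) η

/-- `ν` is an invariant probability measure of the process with state space `Ω`: it is supported on
`Ω`, and `∫ S(t) f dν = ∫ f dν` for every bounded Lipschitz function `f` and every `t ≥ 0`. -/
def IsInvariant {d : ℕ} (a : Site d → ℝ) (Ω : Set (Config d))
    (P : ℝ≥0 → Kernel (Config d) (Config d)) (ν : Measure (Config d)) : Prop :=
  IsProbabilityMeasure ν ∧ ν Ωᶜ = 0 ∧
    ∀ K f, IsLipschitz a Ω K f → (∃ m : ℝ, ∀ η, |f η| ≤ m) →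
      ∀ t : ℝ≥0, ∫ η, semigroup P t f η ∂ν = ∫ η, f η ∂ν

/-- `∫ ℒ f dν = 0` for every bounded cylinder function `f`. -/
def AnnihilatesGenerator {d : ℕ} (g : ℕ → ℕ → ℕ → ℝ) (p : Site d → Site d → ℝ)
    (ν : Measure (Config d)) : Prop :=
  ∀ f, IsBoundedCylinder f →
    Integrable (generator g p f) ν ∧ ∫ η, generator g p f η ∂ν = 0

/-- The assumption on a process that its invariant probability measures are exactly the probability
measures `ν` with `∫ ℒ f dν = 0` for every bounded cylinder function `f`. -/
def InvarianceByGenerator {d : ℕ} (g : ℕ → ℕ → ℕ → ℝ) (p : Site d → Site d → ℝ)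
    (a : Site d → ℝ) (Ω : Set (Config d)) (P : ℝ≥0 → Kernel (Config d) (Config d)) : Prop :=
  ∀ ν : Measure (Config d), IsProbabilityMeasure ν →
    (IsInvariant a Ω P ν ↔ AnnihilatesGenerator g p ν)

/-- The translation invariant product measure on `ℕ^(ℤ^d)` with single site marginal `μ`. -/
def productMeasure (d : ℕ) (μ : Measure ℕ) : Measure (Config d) :=
  Measure.infinitePi fun _ : Site d => μ

/-- `Z_φ = ∑ n, φ^n μ(n)`. -/
def partitionZ (μ : Measure ℕ) (φ : ℝ≥0) : ℝ≥0∞ :=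
  ∑' n : ℕ, (φ : ℝ≥0∞) ^ n * μ {n}

/-- `∑ n, n φ^n μ(n)`. -/
def momentZ (μ : Measure ℕ) (φ : ℝ≥0) : ℝ≥0∞ :=
  ∑' n : ℕ, (n : ℝ≥0∞) * (φ : ℝ≥0∞) ^ n * μ {n}

/-- The radius of convergence `φ_c` (possibly infinite) of the power series `∑ n, φ^n μ(n)`. -/
def criticalFugacity (μ : Measure ℕ) : ℝ≥0∞ :=
  (FormalMultilinearSeries.ofScalars ℝ (fun n : ℕ => μ.real {n})).radius

/-- The tilted single site marginal `μ_φ(n) = φ^n μ(n) / Z_φ`. -/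
def tilt (μ : Measure ℕ) (φ : ℝ≥0) : Measure ℕ :=
  (partitionZ μ φ)⁻¹ • μ.withDensity fun n => (φ : ℝ≥0∞) ^ n

/-- `Rad(Z)`: the interval `(0, φ_c]` if `φ_c` and `Z_{φ_c}` are finite, `(0, φ_c)` otherwise. -/
def RadZ (μ : Measure ℕ) : Set ℝ≥0 :=
  {φ | 0 < φ ∧ ((φ : ℝ≥0∞) < criticalFugacity μ ∨
    ((φ : ℝ≥0∞) = criticalFugacity μ ∧ partitionZ μ φ < ⊤))}

/-- `Rad(Z')`: the interval `(0, φ_c]` if `φ_c` and `∑ n, n φ_c^n μ(n)` are finite, `(0, φ_c)`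
otherwise. -/
def RadZ' (μ : Measure ℕ) : Set ℝ≥0 :=
  {φ | 0 < φ ∧ ((φ : ℝ≥0∞) < criticalFugacity μ ∨
    ((φ : ℝ≥0∞) = criticalFugacity μ ∧ momentZ μ φ < ⊤))}

end MMP

end

/-! Invariance of a product measure reduces to an algebraic identity for its single-site weights
`m`, and that identity survives the tilt `m(n) ↦ c φ^n m(n)`.

Let `G(α, β)` be `netFlux`: gain minus loss of the weight `m ⊗ m` under jumps between two sites. For
a product measure and a bounded cylinder function `f`, integration by parts gives `∫ ℒ f = ∑ p(x,y)
⟨G, F_xy⟩`, where `F_xy` is the conditional expectation of `f` given the occupation of `x` and `y`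
(`hasSum_integral_generator`). A gradient flux `θ(α) m(β) - m(α) θ(β)` contributes `E(x) - E(y)` to
the pair `(x, y)`, and these terms cancel because a translation-invariant `p` is doubly stochastic.
So only the defect `H = G - (θ ⊗ m - m ⊗ θ)` counts.

It follows that `∫ ℒ f = 0` for all such `f` if `H = 0`, or if `p` is symmetric and `H`
antisymmetric. Conversely (`fluxDefect_of_annihilatesGenerator`), with `θ` the row sums of `G`,
one-site indicators show that `H` has zero marginals, and two-site indicators then give `p(x,y)
H(α,β) + p(y,x) H(β,α) = 0`, which forces one of the two alternatives. A jump preserves `α + β`, so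
tilting multiplies `G`, and with `θ` tilted alike also `H`, by `c² φ^(α+β)`. Both alternatives
persist (`AnnihilatesGenerator.tilt`).

It remains to identify invariance with `∫ ℒ f = 0`. Under (B) this is assumed. Under (S), for
product measures with finite first moment, one direction differentiates `∫ S(t) f` at `t = 0`, and
the other integrates the backward equation and exchanges integrals. Both rest on a single integrable
bound for `|ℒ f|` that depends on `f` only through its Lipschitz constant. -/

namespace MMP

/-! ### Flux of weight between two sites -/

/-- The total jump rate from a site with `α` particles to a site with `β` particles. -/
def pairRate (g : ℕ → ℕ → ℕ → ℝ) (q : ℕ × ℕ) : ℝ :=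
  ∑ k ∈ Finset.Icc 1 q.1, g k q.1 q.2

/-- The generator of the jumps from the first to the second of two sites. -/
def pairGenerator (g : ℕ → ℕ → ℕ → ℝ) (F : ℕ → ℕ → ℝ) (q : ℕ × ℕ) : ℝ :=
  ∑ k ∈ Finset.Icc 1 q.1, g k q.1 q.2 * (F (q.1 - k) (q.2 + k) - F q.1 q.2)

/-- The rate of change of the weight `m ⊗ m` at `(α, β)` under jumps from the first to the second
of two sites. -/
def netFlux (g : ℕ → ℕ → ℕ → ℝ) (m : ℕ → ℝ) (q : ℕ × ℕ) : ℝ :=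
  ∑ k ∈ Finset.Icc 1 q.2, g k (q.1 + k) (q.2 - k) * (m (q.1 + k) * m (q.2 - k))
    - m q.1 * m q.2 * pairRate g q

/-- The pairing of `netFlux` with a function on pairs. -/
noncomputable def fluxPairing (g : ℕ → ℕ → ℕ → ℝ) (m : ℕ → ℝ) (F : ℕ → ℕ → ℝ) : ℝ :=
  ∑' q : ℕ × ℕ, netFlux g m q * F q.1 q.2

lemma IsRate.pairRate_nonneg {g : ℕ → ℕ → ℕ → ℝ} (hg : IsRate g) (q : ℕ × ℕ) :
    0 ≤ pairRate g q :=
  Finset.sum_nonneg fun _ _ => hg.nonneg _ _ _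

lemma abs_pairGenerator_le {g : ℕ → ℕ → ℕ → ℝ} (hg : IsRate g) {F : ℕ → ℕ → ℝ} {c : ℝ}
    (hF : ∀ α β, |F α β| ≤ c) (q : ℕ × ℕ) : |pairGenerator g F q| ≤ pairRate g q * (2 * c) := by
  unfold pairGenerator pairRate
  rw [Finset.sum_mul]
  refine (Finset.abs_sum_le_sum_abs _ _).trans (Finset.sum_le_sum fun k _ => ?_)
  rw [abs_mul, abs_of_nonneg (hg.nonneg _ _ _)]
  refine mul_le_mul_of_nonneg_left ?_ (hg.nonneg _ _ _)
  refine (abs_sub _ _).trans ?_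
  linarith [hF (q.1 - k) (q.2 + k), hF q.1 q.2]

section Sums

variable {g : ℕ → ℕ → ℕ → ℝ} (hg : IsRate g) {m : ℕ → ℝ} (hm : ∀ n, 0 ≤ m n)
  (hr : Summable fun q : ℕ × ℕ => m q.1 * m q.2 * pairRate g q)

include hg hm hr

/-- Since `g` vanishes at `k = 0` and for `k > α`, the finite sums over `k` are sums over all of
`ℕ`. The resulting triple series converges absolutely by `hr`, so it may be reindexed freely. -/
lemma hasSum_flux_loss {F : ℕ → ℕ → ℕ → ℝ} {c : ℝ} (hF : ∀ α β k, |F α β k| ≤ c) :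
    Summable (fun t : (ℕ × ℕ) × ℕ => m t.1.1 * m t.1.2 * g t.2 t.1.1 t.1.2 * F t.1.1 t.1.2 t.2) ∧
    HasSum (fun q : ℕ × ℕ => m q.1 * m q.2 * ∑ k ∈ Finset.Icc 1 q.1, g k q.1 q.2 * F q.1 q.2 k)
      (∑' t : (ℕ × ℕ) × ℕ, m t.1.1 * m t.1.2 * g t.2 t.1.1 t.1.2 * F t.1.1 t.1.2 t.2) := by
  have key : ∀ (H : ℕ → ℝ) (q : ℕ × ℕ), HasSum (fun k => m q.1 * m q.2 * g k q.1 q.2 * H k)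
      (m q.1 * m q.2 * ∑ k ∈ Finset.Icc 1 q.1, g k q.1 q.2 * H k) := by
    intro H q
    rw [Finset.mul_sum]
    simp_rw [← mul_assoc]
    refine hasSum_sum_of_ne_finset_zero fun k hk => ?_
    rw [Finset.mem_Icc, not_and_or] at hk
    rcases hk with hk | hk
    · rw [show k = 0 by omega, hg.zero]; simp
    · rw [hg.eq_zero_of_lt _ _ _ (by omega)]; simp
  have hA : Summable (fun t : (ℕ × ℕ) × ℕ => m t.1.1 * m t.1.2 * g t.2 t.1.1 t.1.2) := by
    rw [summable_prod_of_nonneg]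
    · refine ⟨fun q => by simpa using (key (fun _ => 1) q).summable, ?_⟩
      refine hr.congr fun q => ?_
      simpa [pairRate] using (key (fun _ => 1) q).tsum_eq.symm
    · intro t
      exact mul_nonneg (mul_nonneg (hm _) (hm _)) (hg.nonneg _ _ _)
  have hS : Summable (fun t : (ℕ × ℕ) × ℕ =>
      m t.1.1 * m t.1.2 * g t.2 t.1.1 t.1.2 * F t.1.1 t.1.2 t.2) := by
    refine Summable.of_norm_bounded (hA.mul_right c) fun t => ?_
    rw [norm_mul, Real.norm_of_nonneg
      (mul_nonneg (mul_nonneg (hm _) (hm _)) (hg.nonneg t.2 t.1.1 t.1.2))]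
    exact mul_le_mul_of_nonneg_left (hF _ _ _)
      (mul_nonneg (mul_nonneg (hm _) (hm _)) (hg.nonneg _ _ _))
  exact ⟨hS, hS.hasSum.prod_fiberwise fun q => key _ q⟩

/-- The triple series over states before a jump is regrouped by the state after it. Truncated
subtraction in `α - k` is harmless because the rate is zero there. -/
lemma hasSum_flux_gain {F : ℕ → ℕ → ℝ} {c : ℝ} (hF : ∀ α β, |F α β| ≤ c) :
    HasSum (fun q : ℕ × ℕ =>
      (∑ k ∈ Finset.Icc 1 q.2, g k (q.1 + k) (q.2 - k) * (m (q.1 + k) * m (q.2 - k))) * F q.1 q.2)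
      (∑' t : (ℕ × ℕ) × ℕ,
        m t.1.1 * m t.1.2 * g t.2 t.1.1 t.1.2 * F (t.1.1 - t.2) (t.1.2 + t.2)) := by
  have h1 := (hasSum_flux_loss hg hm hr
    (F := fun α β k => F (α - k) (β + k)) fun _ _ _ => hF _ _).1
  -- A jump is coded by the particles left behind, those already at the target, and `k`; `i` yields
  -- the state before the jump, `j` the state after it.
  let i : (ℕ × ℕ) × ℕ → (ℕ × ℕ) × ℕ := fun t => ((t.1.1 + t.2, t.1.2), t.2)
  let j : (ℕ × ℕ) × ℕ → (ℕ × ℕ) × ℕ := fun t => ((t.1.1, t.1.2 + t.2), t.2)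
  have hi : Function.Injective i := by
    rintro ⟨⟨a, b⟩, k⟩ ⟨⟨a', b'⟩, k'⟩ h
    simp only [i, Prod.mk.injEq] at h ⊢
    omega
  have hj : Function.Injective j := by
    rintro ⟨⟨a, b⟩, k⟩ ⟨⟨a', b'⟩, k'⟩ h
    simp only [j, Prod.mk.injEq] at h ⊢
    omega
  let A : (ℕ × ℕ) × ℕ → ℝ := fun t =>
    m t.1.1 * m t.1.2 * g t.2 t.1.1 t.1.2 * F (t.1.1 - t.2) (t.1.2 + t.2)
  let B : (ℕ × ℕ) × ℕ → ℝ := fun t => if t.2 ≤ t.1.2 then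
    g t.2 (t.1.1 + t.2) (t.1.2 - t.2) * (m (t.1.1 + t.2) * m (t.1.2 - t.2)) * F t.1.1 t.1.2 else 0
  have hAB : A ∘ i = B ∘ j := by
    funext ⟨⟨a, b⟩, k⟩
    simp only [A, B, i, j, Function.comp_apply, Nat.add_sub_cancel, Nat.le_add_left, if_true]
    ring
  have hAi : ∀ t ∉ Set.range i, A t = 0 := by
    rintro ⟨⟨a, b⟩, k⟩ ht
    have : a < k := by
      by_contra hk
      exact ht ⟨((a - k, b), k), by simp only [i, Prod.mk.injEq, and_true]; omega⟩
    simp [A, hg.eq_zero_of_lt _ _ _ this]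
  have hBj : ∀ t ∉ Set.range j, B t = 0 := by
    rintro ⟨⟨a, b⟩, k⟩ ht
    have : ¬ k ≤ b := by
      intro hk
      exact ht ⟨((a, b - k), k), by simp only [j, Prod.mk.injEq, true_and, and_true]; omega⟩
    simp [B, this]
  have hB : HasSum B (∑' t, A t) :=
    (hj.hasSum_iff hBj).1 (hAB ▸ (hi.hasSum_iff hAi).2 h1.hasSum)
  refine hB.prod_fiberwise fun q => ?_
  rw [Finset.sum_mul]
  have hs : ∀ k ∈ Finset.Icc 1 q.2,
      g k (q.1 + k) (q.2 - k) * (m (q.1 + k) * m (q.2 - k)) * F q.1 q.2 = B (q, k) := by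
    intro k hk
    simp [B, (Finset.mem_Icc.1 hk).2]
  rw [Finset.sum_congr rfl hs]
  refine hasSum_sum_of_ne_finset_zero fun k hk => ?_
  rw [Finset.mem_Icc, not_and_or] at hk
  rcases hk with hk | hk
  · simp [B, show k = 0 by omega, hg.zero]
  · simp [B, hk]

/-- Integration by parts for the jumps between two sites. -/
lemma hasSum_netFlux_mul {F : ℕ → ℕ → ℝ} {c : ℝ} (hF : ∀ α β, |F α β| ≤ c) :
    HasSum (fun q : ℕ × ℕ => netFlux g m q * F q.1 q.2)
      (∑' q : ℕ × ℕ, m q.1 * m q.2 * pairGenerator g F q) := by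
  have h1 := hasSum_flux_loss hg hm hr (F := fun α β k => F (α - k) (β + k)) fun _ _ _ => hF _ _
  have h2 := hasSum_flux_loss hg hm hr (F := fun α β _ => F α β) fun _ _ _ => hF _ _
  have h3 := hasSum_flux_gain hg hm hr hF
  have h4 := (h1.2.sub h2.2).tsum_eq
  have h5 := h3.sub h2.2
  rw [← h4] at h5
  have e1 : ∀ q : ℕ × ℕ, m q.1 * m q.2 * pairGenerator g F q =
      m q.1 * m q.2 * ∑ k ∈ Finset.Icc 1 q.1, g k q.1 q.2 * F (q.1 - k) (q.2 + k) -
        m q.1 * m q.2 * ∑ k ∈ Finset.Icc 1 q.1, g k q.1 q.2 * F q.1 q.2 := fun q => by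
    simp only [pairGenerator, mul_sub, Finset.sum_sub_distrib]
  have e2 : ∀ q : ℕ × ℕ, netFlux g m q * F q.1 q.2 =
      (∑ k ∈ Finset.Icc 1 q.2, g k (q.1 + k) (q.2 - k) * (m (q.1 + k) * m (q.2 - k))) * F q.1 q.2 -
        m q.1 * m q.2 * ∑ k ∈ Finset.Icc 1 q.1, g k q.1 q.2 * F q.1 q.2 := fun q => by
    rw [netFlux, pairRate, ← Finset.sum_mul]
    ring
  simp_rw [e1, e2]
  exact h5

lemma fluxPairing_eq {F : ℕ → ℕ → ℝ} {c : ℝ} (hF : ∀ α β, |F α β| ≤ c) :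
    fluxPairing g m F = ∑' q : ℕ × ℕ, m q.1 * m q.2 * pairGenerator g F q :=
  (hasSum_netFlux_mul hg hm hr hF).tsum_eq

lemma summable_netFlux_mul {F : ℕ → ℕ → ℝ} {c : ℝ} (hF : ∀ α β, |F α β| ≤ c) :
    Summable fun q : ℕ × ℕ => netFlux g m q * F q.1 q.2 :=
  (hasSum_netFlux_mul hg hm hr hF).summable

lemma summable_netFlux : Summable (netFlux g m) := by
  simpa using summable_netFlux_mul hg hm hr (F := fun _ _ => 1) (c := 1) (by simp)

/-- Conservation of mass: pair the flux with the constant `1`, on which the pair generator vanishes.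
-/
lemma tsum_netFlux : ∑' q, netFlux g m q = 0 := by
  have := fluxPairing_eq hg hm hr (F := fun _ _ => 1) (c := 1) (by simp)
  simpa [fluxPairing, pairGenerator] using this

end Sums

/-! ### Sums and integrals -/

open Function

lemma summable_real_mul_norm {X : Type*} [Countable X] [MeasurableSpace X]
    [MeasurableSingletonClass X] {ρ : Measure X} {f : X → ℝ} (hf : Integrable f ρ) :
    Summable fun x => ρ.real {x} * ‖f x‖ := by
  have h := hf.norm
  rw [← Measure.sum_smul_dirac ρ] at h
  refine (hasSum_integral_measure h).summable.congr fun x => ?_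
  rw [integral_smul_measure, integral_dirac, measureReal_def, smul_eq_mul]

/-- A series of integrable functions whose `L¹`-norms are summable converges almost everywhere and
has an integrable sum. -/
lemma ae_summable_of_summable_integral {X ι : Type*} [Countable ι] [MeasurableSpace X]
    {ρ : Measure X} {F : ι → X → ℝ} (h0 : ∀ i x, 0 ≤ F i x) (hi : ∀ i, Integrable (F i) ρ)
    (hs : Summable fun i => ∫ x, F i x ∂ρ) :
    (∀ᵐ x ∂ρ, Summable fun i => F i x) ∧ Integrable (fun x => ∑' i, F i x) ρ := by
  have hm : ∀ i, AEMeasurable (fun x => ENNReal.ofReal (F i x)) ρ :=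
    fun i => (hi i).aemeasurable.ennreal_ofReal
  have e : ∫⁻ x, ∑' i, ENNReal.ofReal (F i x) ∂ρ = ENNReal.ofReal (∑' i, ∫ x, F i x ∂ρ) := by
    rw [lintegral_tsum hm, ENNReal.ofReal_tsum_of_nonneg (fun i => integral_nonneg (h0 i)) hs]
    exact tsum_congr fun i => (ofReal_integral_eq_lintegral_ofReal (hi i)
      (ae_of_all _ (h0 i))).symm
  have hlt : ∫⁻ x, ∑' i, ENNReal.ofReal (F i x) ∂ρ ≠ ⊤ := e ▸ ENNReal.ofReal_ne_top
  have hae : ∀ᵐ x ∂ρ, Summable fun i => F i x := by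
    filter_upwards [ae_lt_top' (AEMeasurable.tsum hm) hlt] with x hx
    have := ENNReal.summable_toReal hx.ne
    exact this.congr fun i => (ENNReal.toReal_ofReal (h0 i x))
  refine ⟨hae, ?_⟩
  have h1 : Integrable (fun x => (∑' i, ENNReal.ofReal (F i x)).toReal) ρ :=
    integrable_toReal_of_lintegral_ne_top (AEMeasurable.tsum hm) hlt
  refine h1.congr ?_
  filter_upwards [hae] with x hx
  rw [← ENNReal.ofReal_tsum_of_nonneg (fun i => h0 i x) hx,
    ENNReal.toReal_ofReal (tsum_nonneg fun i => h0 i x)]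

/-! ### Product measures and conditioning on one or two sites -/

section Product

variable {d : ℕ} (μ : Measure ℕ) [IsProbabilityMeasure μ]

instance : IsProbabilityMeasure (productMeasure d μ) := by
  unfold productMeasure
  infer_instance

lemma measurePreserving_eval (x : Site d) :
    MeasurePreserving (fun η : Config d => η x) (productMeasure d μ) μ :=
  ⟨measurable_pi_apply x, Measure.infinitePi_map_eval _ x⟩

/-- Resampling a coordinate preserves a product measure. -/
lemma measurePreserving_update (x : Site d) :
    MeasurePreserving (fun q : Config d × ℕ => update q.1 x q.2)
      ((productMeasure d μ).prod μ) (productMeasure d μ) := by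
  refine ⟨measurable_update', ?_⟩
  refine Measure.eq_infinitePi _ fun s t ht => ?_
  rw [Measure.map_apply measurable_update' (MeasurableSet.pi s.countable_toSet fun i _ => ht i)]
  by_cases hx : x ∈ s
  · have : (fun q : Config d × ℕ => update q.1 x q.2) ⁻¹' (Set.pi s t) =
        (Set.pi (s.erase x : Finset (Site d)) t) ×ˢ (t x) := by
      ext ⟨η, n⟩
      simp only [Set.mem_preimage, Set.mem_pi, Set.mem_prod, Finset.mem_coe, Finset.mem_erase]
      constructor
      · refine fun h => ⟨fun i hi => ?_, by simpa using h x hx⟩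
        simpa [hi.1] using h i hi.2
      · rintro ⟨h1, h2⟩ i hi
        by_cases hix : i = x
        · subst hix; simpa using h2
        · simpa [hix] using h1 i ⟨hix, hi⟩
    rw [this, Measure.prod_prod, productMeasure, Measure.infinitePi_pi _ fun i _ => ht i,
      Finset.prod_erase_mul _ _ hx]
  · have : (fun q : Config d × ℕ => update q.1 x q.2) ⁻¹' (Set.pi s t) =
        (Set.pi s t) ×ˢ Set.univ := by
      ext ⟨η, n⟩
      simp only [Set.mem_preimage, Set.mem_pi, Set.mem_prod, Finset.mem_coe, Set.mem_univ, and_true]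
      refine forall₂_congr fun i hi => ?_
      rw [update_of_ne (by rintro rfl; exact hx hi)]
    rw [this, Measure.prod_prod, productMeasure, Measure.infinitePi_pi _ fun i _ => ht i,
      measure_univ, mul_one]

/-- Resampling two coordinates preserves a product measure. -/
lemma measurePreserving_update_update (x y : Site d) :
    MeasurePreserving (fun q : (ℕ × ℕ) × Config d => update (update q.2 x q.1.1) y q.1.2)
      ((μ.prod μ).prod (productMeasure d μ)) (productMeasure d μ) := by
  have h1 := measurePreserving_update μ x
  have h2 := measurePreserving_update μ y
  have h3 := h2.comp (h1.prod (MeasurePreserving.id μ))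
  have h4 : MeasurePreserving (fun q : (ℕ × ℕ) × Config d => ((q.2, q.1.1), q.1.2))
      ((μ.prod μ).prod (productMeasure d μ)) (((productMeasure d μ).prod μ).prod μ) :=
    (measurePreserving_prodAssoc (productMeasure d μ) μ μ).symm.comp Measure.measurePreserving_swap
  exact h3.comp h4

lemma measurePreserving_eval_eval {x y : Site d} (hxy : x ≠ y) :
    MeasurePreserving (fun η : Config d => (η x, η y)) (productMeasure d μ) (μ.prod μ) := by
  have hm : Measurable fun η : Config d => (η x, η y) :=
    (measurable_pi_apply x).prodMk (measurable_pi_apply y)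
  refine ⟨hm, ?_⟩
  have h := measurePreserving_update_update μ x y
  conv_lhs => rw [← h.map_eq]
  rw [Measure.map_map hm h.measurable]
  have : ((fun η : Config d => (η x, η y)) ∘
      fun q : (ℕ × ℕ) × Config d => update (update q.2 x q.1.1) y q.1.2) = Prod.fst := by
    funext q
    simp [hxy]
  rw [this]
  exact measurePreserving_fst.map_eq

/-- The conditional expectation of `f` given the number of particles at `x`. -/
noncomputable def condSite (f : Config d → ℝ) (x : Site d) (α : ℕ) : ℝ :=
  ∫ η, f (update η x α) ∂(productMeasure d μ)

/-- The conditional expectation of `f` given the number of particles at `x` and `y`. -/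
noncomputable def condPair (f : Config d → ℝ) (x y : Site d) (α β : ℕ) : ℝ :=
  ∫ η, f (update (update η x α) y β) ∂(productMeasure d μ)

variable {μ}

omit [IsProbabilityMeasure μ] in
lemma condPair_comm (f : Config d → ℝ) {x y : Site d} (hxy : x ≠ y) (α β : ℕ) :
    condPair μ f x y α β = condPair μ f y x β α := by
  unfold condPair
  simp_rw [update_comm hxy]

lemma abs_integral_le_of_abs_le {X : Type*} [MeasurableSpace X] {ρ : Measure X}
    [IsProbabilityMeasure ρ] {f : X → ℝ} {c : ℝ} (h : ∀ x, |f x| ≤ c) : |∫ x, f x ∂ρ| ≤ c := by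
  simpa using norm_integral_le_of_norm_le_const (μ := ρ) (f := f) (ae_of_all _ h)

lemma abs_condPair_le {f : Config d → ℝ} {c : ℝ} (hc : ∀ η, |f η| ≤ c) (x y : Site d) (α β : ℕ) :
    |condPair μ f x y α β| ≤ c :=
  abs_integral_le_of_abs_le fun _ => hc _

lemma abs_condSite_le {f : Config d → ℝ} {c : ℝ} (hc : ∀ η, |f η| ≤ c) (x : Site d) (α : ℕ) :
    |condSite μ f x α| ≤ c :=
  abs_integral_le_of_abs_le fun _ => hc _

lemma integrable_of_bounded {X : Type*} [MeasurableSpace X] {ρ : Measure X}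
    [IsFiniteMeasure ρ] {f : X → ℝ} (hf : Measurable f) {c : ℝ} (h : ∀ x, |f x| ≤ c) :
    Integrable f ρ :=
  Integrable.of_bound hf.aestronglyMeasurable c (ae_of_all _ h)

lemma integral_condSite {f : Config d → ℝ} (hf : Measurable f) {c : ℝ} (hc : ∀ η, |f η| ≤ c)
    (x : Site d) : ∫ α, condSite μ f x α ∂μ = ∫ η, f η ∂(productMeasure d μ) := by
  have h := measurePreserving_update (d := d) μ x
  have hi : Integrable (fun q : Config d × ℕ => f (update q.1 x q.2))
      ((productMeasure d μ).prod μ) :=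
    integrable_of_bounded (hf.comp h.measurable) fun _ => hc _
  conv_rhs => rw [← h.map_eq]
  rw [integral_map h.aemeasurable (h.map_eq.symm ▸ hf.aestronglyMeasurable),
    integral_prod_symm _ hi]
  rfl

lemma integral_condPair_right {f : Config d → ℝ} (hf : Measurable f) {c : ℝ}
    (hc : ∀ η, |f η| ≤ c) {x y : Site d} (hxy : x ≠ y) (α : ℕ) :
    ∫ β, condPair μ f x y α β ∂μ = condSite μ f x α := by
  have := integral_condSite (μ := μ) (f := fun η => f (update η x α))
    (hf.comp measurable_update_left) (fun _ => hc _) y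
  simp only [condSite, condPair] at this ⊢
  simp_rw [update_comm hxy]
  exact this

/-- Averaging over two coordinates first. -/
lemma integral_eq_integral_prod {f : Config d → ℝ} (hf : Integrable f (productMeasure d μ))
    (x y : Site d) : ∫ η, f η ∂(productMeasure d μ) =
      ∫ q : ℕ × ℕ, ∫ η, f (update (update η x q.1) y q.2) ∂(productMeasure d μ) ∂(μ.prod μ) := by
  have h := measurePreserving_update_update (d := d) μ x y
  have h1 := h.integrable_comp_of_integrable hf
  conv_lhs => rw [← h.map_eq]
  rw [integral_map h.aemeasurable (h.map_eq.symm ▸ hf.aestronglyMeasurable)]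
  exact integral_prod _ h1

end Product

/-! ### Double stochasticity of the transition probability -/

section Transition

variable {d : ℕ} {p : Site d → Site d → ℝ}

/-- `p x y` depends only on `y - x`, so a column is a reindexed row. -/
lemma IsTransition.hasSum_col (hp : IsTransition p) (y : Site d) :
    HasSum (fun x => p x y) 1 := by
  have h := (Equiv.subLeft y).hasSum_iff.2 (hp.hasSum 0)
  convert h using 2 with x
  have := hp.translation x y (-x)
  simpa [sub_eq_add_neg] using this.symm

lemma IsTransition.hasSum_mul_fst (hp : IsTransition p) {E : Site d → ℝ} (hE : Summable E) :
    HasSum (fun xy : Site d × Site d => p xy.1 xy.2 * E xy.1) (∑' x, E x) := by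
  have h : ∀ x, HasSum (fun y => p x y * E x) (E x) := fun x => by
    simpa using (hp.hasSum x).mul_right (E x)
  have habs : ∀ x, HasSum (fun y => |p x y * E x|) |E x| := fun x => by
    simpa [abs_mul, abs_of_nonneg (hp.nonneg _ _)] using (hp.hasSum x).mul_right |E x|
  have hs : Summable fun xy : Site d × Site d => p xy.1 xy.2 * E xy.1 := by
    rw [← summable_abs_iff, summable_prod_of_nonneg fun _ => abs_nonneg _]
    exact ⟨fun x => (habs x).summable, hE.abs.congr fun x => (habs x).tsum_eq.symm⟩
  rw [(hs.hasSum.prod_fiberwise h).tsum_eq]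
  exact hs.hasSum

lemma IsTransition.swap (hp : IsTransition p) : IsTransition fun x y => p y x where
  nonneg _ _ := hp.nonneg _ _
  hasSum := hp.hasSum_col
  translation _ _ _ := hp.translation _ _ _
  irreducible x y := by
    have h := hp.irreducible y x
    induction h with
    | refl => exact .refl
    | tail _ h2 ih => exact .head h2 ih

/-- The total agrees with that of `hasSum_mul_fst`; hence `∑ p(x,y) (E x - E y) = 0`, which removes
gradient fluxes. -/
lemma IsTransition.hasSum_mul_snd (hp : IsTransition p) {E : Site d → ℝ} (hE : Summable E) :
    HasSum (fun xy : Site d × Site d => p xy.1 xy.2 * E xy.2) (∑' x, E x) :=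
  (Equiv.prodComm _ _).hasSum_iff.1 (hp.swap.hasSum_mul_fst hE)

end Transition

/-! ### The generator as a sum of two-site terms -/

section Generator

variable {d : ℕ} {g : ℕ → ℕ → ℕ → ℝ}

/-- The part of the generator that describes the jumps from `x` to `y`, at unit speed. -/
noncomputable def jumpTerm (g : ℕ → ℕ → ℕ → ℝ) (f : Config d → ℝ) (x y : Site d) (η : Config d) :
    ℝ :=
  ∑ k ∈ Finset.Icc 1 (η x), g k (η x) (η y) * (f (jump x y k η) - f η)

lemma generator_eq (g : ℕ → ℕ → ℕ → ℝ) (p : Site d → Site d → ℝ) (f : Config d → ℝ)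
    (η : Config d) :
    generator g p f η = ∑' xy : Site d × Site d, p xy.1 xy.2 * jumpTerm g f xy.1 xy.2 η := by
  simp only [generator, jumpTerm, Finset.mul_sum, mul_assoc]

lemma jump_self (x : Site d) {k : ℕ} {η : Config d} (hk : k ≤ η x) : jump x x k η = η := by
  funext z
  by_cases hz : z = x
  · subst hz; simp [jump, hk]
  · simp [jump, hz]

lemma jump_eq_update {x y : Site d} (hxy : x ≠ y) {k : ℕ} {η : Config d} (hk : k ≤ η x) :
    jump x y k η = update (update η x (η x - k)) y (η y + k) := by
  funext z
  by_cases hy : z = y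
  · subst hy; simp [jump, hk, hxy.symm]
  · by_cases hz : z = x
    · subst hz; simp [jump, hk, hy]
    · simp [jump, hz, hy]

lemma jumpTerm_self (g : ℕ → ℕ → ℕ → ℝ) (f : Config d → ℝ) (x : Site d) (η : Config d) :
    jumpTerm g f x x η = 0 :=
  Finset.sum_eq_zero fun k hk => by rw [jump_self x (Finset.mem_Icc.1 hk).2, sub_self, mul_zero]

lemma abs_jumpTerm_le (hg : IsRate g) {f : Config d → ℝ} {c : ℝ} (hc : ∀ η, |f η| ≤ c)
    (x y : Site d) (η : Config d) :
    |jumpTerm g f x y η| ≤ pairRate g (η x, η y) * (2 * c) := by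
  unfold jumpTerm pairRate
  rw [Finset.sum_mul]
  refine (Finset.abs_sum_le_sum_abs _ _).trans (Finset.sum_le_sum fun k _ => ?_)
  rw [abs_mul, abs_of_nonneg (hg.nonneg _ _ _)]
  refine mul_le_mul_of_nonneg_left ?_ (hg.nonneg _ _ _)
  refine (abs_sub _ _).trans ?_
  linarith [hc (jump x y k η), hc η]

lemma measurable_jump (x y : Site d) (k : ℕ) : Measurable (jump x y k : Config d → Config d) := by
  refine measurable_pi_lambda _ fun z => ?_
  refine Measurable.ite (measurableSet_le measurable_const (measurable_pi_apply x)) ?_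
    (measurable_pi_apply z)
  exact ((measurable_of_countable fun n : ℕ => (n - if z = x then k else 0) +
    (if z = y then k else 0)).comp (measurable_pi_apply z))

/-- The number of summands is itself random, so it is first made an independent discrete variable
and then substituted. The parameter space `T` will be time, for Fubini's theorem. -/
lemma measurable_uncurry_jumpTerm {T : Type*} [MeasurableSpace T] {v : T → Config d → ℝ}
    (hv : Measurable (uncurry v)) (x y : Site d) :
    Measurable fun q : T × Config d => jumpTerm g (v q.1) x y q.2 := by
  have h : Measurable fun r : (T × Config d) × ℕ => ∑ k ∈ Finset.Icc 1 r.2,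
      g k (r.1.2 x) (r.1.2 y) * (v r.1.1 (jump x y k r.1.2) - v r.1.1 r.1.2) := by
    refine measurable_from_prod_countable_left fun n => ?_
    refine Finset.measurable_fun_sum (Finset.Icc 1 n) fun k _ => ?_
    have h1 : Measurable fun q : T × Config d => g k (q.2 x) (q.2 y) :=
      (measurable_of_countable fun r : ℕ × ℕ => g k r.1 r.2).comp
        (((measurable_pi_apply x).comp measurable_snd).prodMk
          ((measurable_pi_apply y).comp measurable_snd) :
          Measurable fun q : T × Config d => (q.2 x, q.2 y))
    have h2 : Measurable fun q : T × Config d => v q.1 (jump x y k q.2) :=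
      hv.comp (measurable_fst.prodMk ((measurable_jump x y k).comp measurable_snd))
    exact h1.mul (h2.sub hv)
  exact h.comp (measurable_id.prodMk ((measurable_pi_apply x).comp measurable_snd))

lemma measurable_uncurry_generator {T : Type*} [MeasurableSpace T] {v : T → Config d → ℝ}
    (hv : Measurable (uncurry v)) (p : Site d → Site d → ℝ) :
    Measurable fun q : T × Config d => generator g p (v q.1) q.2 := by
  simp only [generator_eq]
  exact Measurable.tsum fun xy => (measurable_uncurry_jumpTerm hv _ _).const_mul _

lemma measurable_jumpTerm {f : Config d → ℝ} (hf : Measurable f) (x y : Site d) :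
    Measurable (jumpTerm g f x y) :=
  (measurable_uncurry_jumpTerm (T := Unit) (v := fun _ => f) (hf.comp measurable_snd) x y).comp
    (measurable_const.prodMk measurable_id : Measurable fun η : Config d => (((), η)))

lemma measurable_generator {f : Config d → ℝ} (hf : Measurable f) (p : Site d → Site d → ℝ) :
    Measurable (generator g p f) :=
  (measurable_uncurry_generator (T := Unit) (v := fun _ => f) (hf.comp measurable_snd) p).comp
    (measurable_const.prodMk measurable_id : Measurable fun η : Config d => (((), η)))

lemma IsBoundedCylinder.measurable {f : Config d → ℝ} (hf : IsBoundedCylinder f) :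
    Measurable f := by
  obtain ⟨-, V, hV⟩ := hf
  obtain ⟨h, rfl⟩ := dependsOn_iff_exists_comp.1 hV
  exact (measurable_of_countable h).comp (measurable_pi_lambda _ fun i => measurable_pi_apply _)

end Generator

/-! ### Expectation of the generator under a product measure -/

section Integral

variable {d : ℕ} {g : ℕ → ℕ → ℕ → ℝ} (hg : IsRate g) {μ : Measure ℕ} [IsProbabilityMeasure μ]
  (hr : Integrable (pairRate g) (μ.prod μ))

omit [IsProbabilityMeasure μ] in
include hr in
lemma summable_weight_mul_pairRate (hg : IsRate g) :
    Summable fun q : ℕ × ℕ => μ.real {q.1} * μ.real {q.2} * pairRate g q := by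
  refine (summable_real_mul_norm hr).congr fun q => ?_
  rw [Real.norm_of_nonneg (hg.pairRate_nonneg q), ← Prod.mk.eta (p := q),
    ← Set.singleton_prod_singleton, measureReal_prod_prod]

include hg hr

omit [IsProbabilityMeasure μ] in
lemma integral_pairGenerator {F : ℕ → ℕ → ℝ} {c : ℝ} (hF : ∀ α β, |F α β| ≤ c) :
    ∫ q, pairGenerator g F q ∂(μ.prod μ) = fluxPairing g (fun n => μ.real {n}) F := by
  rw [fluxPairing_eq hg (fun _ => measureReal_nonneg) (summable_weight_mul_pairRate hr hg) hF,
    integral_countable]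
  · refine tsum_congr fun q => ?_
    rw [← Prod.mk.eta (p := q), ← Set.singleton_prod_singleton, measureReal_prod_prod, smul_eq_mul]
  · exact (hr.mul_const (2 * c)).mono' (measurable_of_countable _).aestronglyMeasurable
      (ae_of_all _ fun q => abs_pairGenerator_le hg hF q)

lemma integrable_jumpTerm {f : Config d → ℝ} (hf : Measurable f) {c : ℝ} (hc : ∀ η, |f η| ≤ c)
    {x y : Site d} (hxy : x ≠ y) : Integrable (jumpTerm g f x y) (productMeasure d μ) := by
  have h := (measurePreserving_eval_eval (μ := μ) hxy).integrable_comp_of_integrable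
    (hr.mul_const (2 * c))
  exact h.mono' (measurable_jumpTerm hf x y).aestronglyMeasurable
    (ae_of_all _ fun η => abs_jumpTerm_le hg hc x y η)

/-- Integrating out all sites other than `x` and `y` turns the jump term into the pair generator of
`condPair`; integration by parts then moves it onto the weights. -/
lemma integral_jumpTerm {f : Config d → ℝ} (hf : Measurable f) {c : ℝ} (hc : ∀ η, |f η| ≤ c)
    {x y : Site d} (hxy : x ≠ y) : ∫ η, jumpTerm g f x y η ∂(productMeasure d μ) =
      fluxPairing g (fun n => μ.real {n}) (condPair μ f x y) := by
  rw [integral_eq_integral_prod (integrable_jumpTerm hg hr hf hc hxy) x y,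
    ← integral_pairGenerator hg hr (abs_condPair_le hc x y)]
  have hi : ∀ α β : ℕ, Integrable (fun η => f (update (update η x α) y β)) (productMeasure d μ) :=
    fun α β => integrable_of_bounded
      (hf.comp (measurable_update_left.comp measurable_update_left)) fun _ => hc _
  refine integral_congr_ae (ae_of_all _ fun q => ?_)
  obtain ⟨α, β⟩ := q
  have e : ∀ η : Config d, jumpTerm g f x y (update (update η x α) y β) =
      ∑ k ∈ Finset.Icc 1 α, g k α β * (f (update (update η x (α - k)) y (β + k)) -
        f (update (update η x α) y β)) := by
    intro η
    have e1 : update (update η x α) y β x = α := by simp [hxy]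
    have e2 : update (update η x α) y β y = β := by simp
    unfold jumpTerm
    rw [e1, e2]
    refine Finset.sum_congr rfl fun k hk => ?_
    rw [jump_eq_update hxy (by rw [e1]; exact (Finset.mem_Icc.1 hk).2), e1, e2,
      update_comm hxy, update_idem, update_comm hxy.symm, update_idem]
  simp only [e, pairGenerator]
  rw [integral_finsetSum _ fun k _ => (Integrable.const_mul (f := fun η =>
    f (update (update η x (α - k)) y (β + k)) - f (update (update η x α) y β))
      ((hi _ _).sub (hi _ _)) _)]
  refine Finset.sum_congr rfl fun k _ => ?_
  rw [integral_const_mul, integral_sub (hi _ _) (hi _ _)]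
  rfl

omit hg [IsProbabilityMeasure μ] hr in
lemma jumpTerm_eq_zero_of_dependsOn {f : Config d → ℝ} {V : Finset (Site d)}
    (hV : DependsOn f (V : Set (Site d))) {x y : Site d} (hx : x ∉ V) (hy : y ∉ V)
    (η : Config d) : jumpTerm g f x y η = 0 := by
  refine Finset.sum_eq_zero fun k hk => ?_
  rw [hV (x := jump x y k η) (y := η), sub_self, mul_zero]
  intro z hz
  have hzx : z ≠ x := by rintro rfl; exact hx hz
  have hzy : z ≠ y := by rintro rfl; exact hy hz
  simp [jump, hzx, hzy]

/-- The expectation of `ℒ f` under a product measure. -/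
theorem hasSum_integral_generator {p : Site d → Site d → ℝ} (hp : IsTransition p)
    {f : Config d → ℝ} (hf : IsBoundedCylinder f) :
    Integrable (generator g p f) (productMeasure d μ) ∧
    HasSum (fun xy : Site d × Site d => p xy.1 xy.2 * (if xy.1 = xy.2 then 0 else
      fluxPairing g (fun n => μ.real {n}) (condPair μ f xy.1 xy.2)))
      (∫ η, generator g p f η ∂(productMeasure d μ)) := by
  have hfm := hf.measurable
  obtain ⟨⟨c, hc⟩, V, hV⟩ := hf
  set ν := productMeasure d μ with hν
  have hc0 : 0 ≤ c := (abs_nonneg _).trans (hc 0)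
  let R := ∫ q, pairRate g q ∂(μ.prod μ)
  have hR : 0 ≤ R := integral_nonneg hg.pairRate_nonneg
  let F : Site d × Site d → Config d → ℝ := fun xy η => p xy.1 xy.2 * jumpTerm g f xy.1 xy.2 η
  have hFi : ∀ xy, Integrable (F xy) ν := by
    rintro ⟨x, y⟩
    by_cases hxy : x = y
    · subst hxy; simp [F, jumpTerm_self]
    · exact (integrable_jumpTerm hg hr hfm hc hxy).const_mul _
  -- Only pairs meeting the finite support `V` contribute, so `p x y * (E x + E y)` is a summable
  -- majorant up to a constant.
  let E : Site d → ℝ := fun x => if x ∈ V then 1 else 0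
  have hE0 : ∀ x, 0 ≤ E x := fun x => by simp only [E]; split_ifs <;> simp
  have hE : Summable E := summable_of_ne_finset_zero (s := V) fun x hx => by simp [E, hx]
  have hsum := ((hp.hasSum_mul_fst hE).add (hp.hasSum_mul_snd hE)).summable.mul_right (R * (2 * c))
  have hFn : ∀ xy, ∫ η, |F xy η| ∂ν ≤
      (p xy.1 xy.2 * E xy.1 + p xy.1 xy.2 * E xy.2) * (R * (2 * c)) := by
    rintro ⟨x, y⟩
    have hpos : 0 ≤ (p x y * E x + p x y * E y) * (R * (2 * c)) :=
      mul_nonneg (add_nonneg (mul_nonneg (hp.nonneg _ _) (hE0 _))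
        (mul_nonneg (hp.nonneg _ _) (hE0 _))) (by positivity)
    by_cases hxy : x = y
    · subst hxy; simpa [F, jumpTerm_self] using hpos
    by_cases hxV : x ∈ V ∨ y ∈ V
    · have hb : ∫ η, |F (x, y) η| ∂ν ≤ p x y * (R * (2 * c)) := by
        simp only [F, abs_mul, abs_of_nonneg (hp.nonneg _ _)]
        rw [integral_const_mul]
        refine mul_le_mul_of_nonneg_left ?_ (hp.nonneg _ _)
        have hmp := measurePreserving_eval_eval (μ := μ) hxy
        have e : ∫ η, pairRate g (η x, η y) * (2 * c) ∂ν = R * (2 * c) := by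
          rw [integral_mul_const]
          congr 1
          rw [show R = ∫ q, pairRate g q ∂(ν.map fun η => (η x, η y)) by rw [hmp.map_eq],
            integral_map hmp.aemeasurable (measurable_of_countable _).aestronglyMeasurable]
        rw [← e]
        exact integral_mono (integrable_jumpTerm hg hr hfm hc hxy).abs
          (hmp.integrable_comp_of_integrable (hr.mul_const (2 * c)))
          fun η => abs_jumpTerm_le hg hc x y η
      refine hb.trans ?_
      rw [← mul_add]
      refine mul_le_mul_of_nonneg_right (le_mul_of_one_le_right (hp.nonneg _ _) ?_) (by positivity)
      rcases hxV with h | h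
      · have : E x = 1 := if_pos h
        linarith [hE0 y]
      · have : E y = 1 := if_pos h
        linarith [hE0 x]
    · push Not at hxV
      simpa [F, jumpTerm_eq_zero_of_dependsOn hV hxV.1 hxV.2] using hpos
  have hs : Summable fun xy => ∫ η, ‖F xy η‖ ∂ν :=
    Summable.of_nonneg_of_le (fun _ => integral_nonneg fun _ => norm_nonneg _) hFn hsum
  have hgen : generator g p f = fun η => ∑' xy, F xy η := by
    funext η
    rw [generator_eq]
  have hH := hasSum_integral_of_summable_integral_norm hFi hs
  obtain ⟨hae, hint⟩ := ae_summable_of_summable_integral (fun _ _ => norm_nonneg _)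
    (fun i => (hFi i).norm) hs
  refine ⟨?_, ?_⟩
  · refine hint.mono' (measurable_generator hfm p).aestronglyMeasurable ?_
    filter_upwards [hae] with η hη
    rw [hgen]
    exact norm_tsum_le_tsum_norm hη
  · rw [hgen]
    have e : ∀ xy : Site d × Site d, p xy.1 xy.2 * (if xy.1 = xy.2 then 0 else
        fluxPairing g (fun n => μ.real {n}) (condPair μ f xy.1 xy.2)) = ∫ η, F xy η ∂ν := by
      rintro ⟨x, y⟩
      by_cases hxy : x = y
      · subst hxy; simp [F, jumpTerm_self]
      · simp only [F, hxy, if_false]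
        rw [integral_const_mul, integral_jumpTerm hg hr hfm hc hxy]
    simp_rw [e]
    exact hH

end Integral

/-! ### Gradient fluxes cancel: the sufficient condition -/

/-- The deviation of `netFlux` from the gradient flux with potential `θ`. -/
def fluxDefect (g : ℕ → ℕ → ℕ → ℝ) (m θ : ℕ → ℝ) (q : ℕ × ℕ) : ℝ :=
  netFlux g m q - (θ q.1 * m q.2 - m q.1 * θ q.2)

lemma hasSum_of_eq {ι : Type*} {u v : ι → ℝ} {s : ℝ} (h : HasSum u s) (e : ∀ i, v i = u i) :
    HasSum v s :=
  (funext e : v = u) ▸ h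

lemma hasSum_real_singleton (μ : Measure ℕ) [IsProbabilityMeasure μ] :
    HasSum (fun n => μ.real {n}) 1 := by
  have hi : Integrable (fun _ : ℕ => (1 : ℝ)) μ := integrable_const _
  have h := integral_countable hi
  have hs := summable_real_mul_norm hi
  simp only [integral_const, probReal_univ, smul_eq_mul, mul_one, norm_one] at h hs
  rw [h]
  exact hs.hasSum

section Defect

variable {d : ℕ} {g : ℕ → ℕ → ℕ → ℝ} (hg : IsRate g) {μ : Measure ℕ} [IsProbabilityMeasure μ]

/-- Averaging over the second site leaves a function of `x` alone, so a gradient flux contributes a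
difference of one-site terms. -/
lemma hasSum_potential_mul_condPair {θ : ℕ → ℝ} (hθ : Summable θ) {f : Config d → ℝ}
    (hf : Measurable f) {c : ℝ} (hc : ∀ η, |f η| ≤ c) {x y : Site d} (hxy : x ≠ y) :
    HasSum (fun q : ℕ × ℕ => θ q.1 * μ.real {q.2} * condPair μ f x y q.1 q.2)
      (∑' α, θ α * condSite μ f x α) := by
  have hm := hasSum_real_singleton μ
  have hs : Summable fun q : ℕ × ℕ => θ q.1 * μ.real {q.2} * condPair μ f x y q.1 q.2 := by
    refine Summable.of_norm_bounded ((summable_mul_of_summable_norm hθ.norm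
      hm.summable.norm).norm.mul_right c) fun q => ?_
    rw [norm_mul]
    exact mul_le_mul_of_nonneg_left (abs_condPair_le hc _ _ _ _) (norm_nonneg _)
  have hrow : ∀ α, HasSum (fun β => θ α * μ.real {β} * condPair μ f x y α β)
      (θ α * condSite μ f x α) := fun α => by
    have hi : Integrable (condPair μ f x y α) μ :=
      integrable_of_bounded (measurable_of_countable _) fun β => abs_condPair_le hc _ _ _ _
    have hsum : Summable fun β => μ.real {β} * condPair μ f x y α β := by
      refine Summable.of_norm ((summable_real_mul_norm hi).congr fun β => ?_)
      rw [norm_mul, Real.norm_of_nonneg measureReal_nonneg]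
    have h := hsum.hasSum.mul_left (θ α)
    simp_rw [← mul_assoc] at h
    rw [← integral_condPair_right hf hc hxy α, integral_countable hi]
    exact h
  rw [(hs.hasSum.prod_fiberwise hrow).tsum_eq]
  exact hs.hasSum

variable (hr : Integrable (pairRate g) (μ.prod μ))

include hg hr

lemma summable_fluxDefect {θ : ℕ → ℝ} (hθ : Summable θ) :
    Summable (fluxDefect g (fun n => μ.real {n}) θ) := by
  have hm := hasSum_real_singleton μ
  exact (summable_netFlux hg (fun _ => measureReal_nonneg)
    (summable_weight_mul_pairRate hr hg)).sub ((summable_mul_of_summable_norm hθ.norm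
      hm.summable.norm).sub (summable_mul_of_summable_norm hm.summable.norm hθ.norm))

/-- The expectation of `ℒ f` under a product measure does not see gradient fluxes. -/
theorem hasSum_integral_generator_fluxDefect {p : Site d → Site d → ℝ} (hp : IsTransition p)
    {f : Config d → ℝ} (hf : IsBoundedCylinder f) {θ : ℕ → ℝ} (hθ : Summable θ) :
    HasSum (fun xy : Site d × Site d => p xy.1 xy.2 * (if xy.1 = xy.2 then 0 else
      ∑' q : ℕ × ℕ, fluxDefect g (fun n => μ.real {n}) θ q * condPair μ f xy.1 xy.2 q.1 q.2))
      (∫ η, generator g p f η ∂(productMeasure d μ)) := by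
  have hT := (hasSum_integral_generator hg hr hp hf).2
  have hfm := hf.measurable
  obtain ⟨⟨c, hc⟩, V, hV⟩ := hf
  -- Subtracting the global mean leaves `E x - E y` unchanged and makes `E` vanish off `V`, hence
  -- summable.
  let E : Site d → ℝ := fun x =>
    ∑' α, θ α * condSite μ f x α - ∑' α, θ α * ∫ η, f η ∂(productMeasure d μ)
  have hE : Summable E := by
    refine summable_of_ne_finset_zero (s := V) fun x hx => ?_
    have : ∀ α, condSite μ f x α = ∫ η, f η ∂(productMeasure d μ) := fun α => by
      refine integral_congr_ae (ae_of_all _ fun η => hV fun z hz => ?_)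
      rw [update_of_ne (by rintro rfl; exact hx hz)]
    simp [E, this]
  have hz := (hp.hasSum_mul_fst hE).sub (hp.hasSum_mul_snd hE)
  have hT' := hT.sub hz
  rw [sub_self, sub_zero] at hT'
  refine hasSum_of_eq hT' ?_
  rintro ⟨x, y⟩
  dsimp only
  by_cases hxy : x = y
  · subst hxy; simp
  rw [if_neg hxy, if_neg hxy, ← mul_sub, ← mul_sub]
  congr 1
  have h1 := hasSum_potential_mul_condPair (μ := μ) hθ hfm hc hxy
  have h2 := (Equiv.prodComm ℕ ℕ).hasSum_iff.2
    (hasSum_potential_mul_condPair (μ := μ) hθ hfm hc (Ne.symm hxy))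
  have h3 := (summable_netFlux_mul hg (fun _ => measureReal_nonneg)
    (summable_weight_mul_pairRate hr hg) (abs_condPair_le (μ := μ) hc x y)).hasSum
  have h4 := (h3.sub (h1.sub h2)).tsum_eq
  rw [fluxPairing, show E x - E y = ∑' α, θ α * condSite μ f x α - ∑' α, θ α * condSite μ f y α by
    simp only [E]; ring, ← h4]
  refine tsum_congr fun q => ?_
  simp only [fluxDefect, comp_apply, Equiv.prodComm_apply, Prod.fst_swap, Prod.snd_swap]
  rw [condPair_comm f hxy]
  ring

/-- Sufficient condition for a product measure to annihilate the generator. -/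
theorem annihilatesGenerator_of_fluxDefect {p : Site d → Site d → ℝ} (hp : IsTransition p)
    {θ : ℕ → ℝ} (hθ : Summable θ)
    (h : (∀ q, fluxDefect g (fun n => μ.real {n}) θ q = 0) ∨
      (∀ x y, p x y = p y x) ∧ ∀ q : ℕ × ℕ, fluxDefect g (fun n => μ.real {n}) θ q.swap =
        -fluxDefect g (fun n => μ.real {n}) θ q) :
    AnnihilatesGenerator g p (productMeasure d μ) := by
  intro f hf
  refine ⟨(hasSum_integral_generator hg hr hp hf).1, ?_⟩
  have hT := hasSum_integral_generator_fluxDefect hg hr hp hf hθ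
  rcases h with h | ⟨hsymm, hanti⟩
  · simp only [h, zero_mul, tsum_zero, ite_self, mul_zero] at hT
    exact hT.unique hasSum_zero
  · have hT' := (Equiv.prodComm _ _).hasSum_iff.2 hT
    have hneg := hT.neg
    -- Exchanging `x` and `y` in the series changes the sign of every term, so the sum equals its
    -- own negative.
    have : ∫ η, generator g p f η ∂(productMeasure d μ) =
        -∫ η, generator g p f η ∂(productMeasure d μ) := by
      refine hT'.unique ?_
      refine hasSum_of_eq hneg ?_
      rintro ⟨x, y⟩
      change p y x * (if y = x then (0 : ℝ) else _) = -(p x y * if x = y then (0 : ℝ) else _)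
      by_cases hxy : x = y
      · simp [hxy]
      rw [if_neg hxy, if_neg (Ne.symm hxy), hsymm y x, ← mul_neg, ← tsum_neg,
        ← (Equiv.prodComm ℕ ℕ).tsum_eq]
      congr 1
      refine tsum_congr fun q => ?_
      simp only [Equiv.prodComm_apply, hanti, Prod.fst_swap, Prod.snd_swap]
      rw [condPair_comm f hxy]
      ring
    linarith

end Defect

/-! ### The necessary condition -/

section Necessity

variable {d : ℕ} {g : ℕ → ℕ → ℕ → ℝ} {μ : Measure ℕ}

lemma condPair_eq_of_update_snd {f : Config d → ℝ} {v : Site d}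
    (hv : ∀ η n, f (update η v n) = f η) (u : Site d) (α β : ℕ) :
    condPair μ f u v α β = condSite μ f u α := by
  simp only [condPair, condSite, hv]

lemma condPair_eq_of_update_fst {f : Config d → ℝ} {u v : Site d} (huv : u ≠ v)
    (hu : ∀ η n, f (update η u n) = f η) (α β : ℕ) :
    condPair μ f u v α β = condSite μ f v β := by
  rw [condPair_comm f huv, condPair_eq_of_update_snd hu]

/-- Discards the pairs of sites of which the test function sees only one. -/
lemma tsum_mul_fst_eq_zero {H : ℕ × ℕ → ℝ} (hH : Summable H) {u : ℕ → ℝ} {c : ℝ}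
    (hu : ∀ n, |u n| ≤ c) (h0 : ∀ α, ∑' β, H (α, β) = 0) :
    ∑' q : ℕ × ℕ, H q * u q.1 = 0 := by
  have hs : Summable fun q : ℕ × ℕ => H q * u q.1 := by
    refine Summable.of_norm_bounded (hH.norm.mul_right c) fun q => ?_
    rw [norm_mul]
    exact mul_le_mul_of_nonneg_left (hu _) (norm_nonneg _)
  rw [hs.tsum_prod]
  simp [tsum_mul_right, h0]

/-- Necessary condition for a product measure to annihilate the generator. -/
theorem fluxDefect_of_annihilatesGenerator (hg : IsRate g) [IsProbabilityMeasure μ]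
    (hr : Integrable (pairRate g) (μ.prod μ)) {p : Site d → Site d → ℝ} (hp : IsTransition p)
    (hpos : ∃ x y, x ≠ y ∧ 0 < p x y) (hA : AnnihilatesGenerator g p (productMeasure d μ)) :
    ∃ θ : ℕ → ℝ, (∀ q, fluxDefect g (fun n => μ.real {n}) θ q = 0) ∨
      (∀ x y, p x y = p y x) ∧ ∀ q : ℕ × ℕ, fluxDefect g (fun n => μ.real {n}) θ q.swap =
        -fluxDefect g (fun n => μ.real {n}) θ q := by
  classical
  have hm := hasSum_real_singleton μ
  have hGs := summable_netFlux hg (fun n => measureReal_nonneg (μ := μ) (s := {n}))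
    (summable_weight_mul_pairRate hr hg)
  have hG0 := tsum_netFlux hg (fun n => measureReal_nonneg (μ := μ) (s := {n}))
    (summable_weight_mul_pairRate hr hg)
  -- As `∑ θ = 0` and `∑ m = 1`, this choice makes every row sum of the defect zero.
  let θ : ℕ → ℝ := fun α => ∑' β, netFlux g (fun n => μ.real {n}) (α, β)
  have hθ : HasSum θ 0 := hG0 ▸ hGs.hasSum.prod_fiberwise fun α => (hGs.prod_factor α).hasSum
  set H : ℕ × ℕ → ℝ := fluxDefect g (fun n => μ.real {n}) θ with hHdef
  have hHs : Summable H := summable_fluxDefect hg hr hθ.summable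
  have hT : ∀ f : Config d → ℝ, IsBoundedCylinder f →
      HasSum (fun xy : Site d × Site d => p xy.1 xy.2 * (if xy.1 = xy.2 then 0 else
        ∑' q : ℕ × ℕ, H q * condPair μ f xy.1 xy.2 q.1 q.2)) 0 := fun f hf => by
    have := hasSum_integral_generator_fluxDefect hg hr hp hf hθ.summable
    rwa [(hA f hf).2] at this
  have hrow : ∀ α, ∑' β, H (α, β) = 0 := fun α => by
    have h1 := (hGs.prod_factor α).hasSum.sub
      ((hm.mul_left (θ α)).sub (hθ.mul_left (μ.real {α})))
    rw [mul_one, mul_zero, sub_zero] at h1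
    exact h1.tsum_eq.trans (sub_self _)
  -- Test with the indicator of `η y = β`. Zero row sums remove every jump whose target is not `y`,
  -- leaving the column sum times `∑ p(u,y)` over `u ≠ y`, which is positive by the choice of `y`.
  have hcol : ∀ β, ∑' α, H (α, β) = 0 := by
    obtain ⟨x, y, hxy, hpxy⟩ := hpos
    intro β
    let f : Config d → ℝ := fun η => if η y = β then 1 else 0
    have hfb : ∀ η, |f η| ≤ 1 := fun η => by simp only [f]; split_ifs <;> simp
    have hf : IsBoundedCylinder f := by
      refine ⟨⟨1, hfb⟩, {y}, fun η ζ h => ?_⟩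
      simp only [f, h y (by simp)]
    have hTf := hT f hf
    let q : Site d × Site d → ℝ := fun uv => if uv.1 ≠ uv.2 ∧ uv.2 = y then p uv.1 uv.2 else 0
    have hq0 : ∀ uv, 0 ≤ q uv := fun uv => by
      simp only [q]; split_ifs
      exacts [hp.nonneg _ _, le_rfl]
    have hTq : HasSum (fun uv => q uv * ∑' α, H (α, β)) 0 := by
      refine hasSum_of_eq hTf ?_
      rintro ⟨u, v⟩
      dsimp only
      by_cases huv : u = v
      · simp [q, huv]
      by_cases hv : v = y
      · subst hv
        simp only [q, ne_eq, huv, not_false_eq_true, true_and, if_true, if_false]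
        congr 1
        obtain ⟨δ, hδ⟩ : ∃ δ : ℕ → ℝ, ∀ n, δ n = if n = β then 1 else 0 := ⟨_, fun _ => rfl⟩
        have e : ∀ α γ : ℕ, condPair μ f u v α γ = δ γ := fun α γ => by
          simp [condPair, f, hδ]
        simp only [e]
        rw [← (Equiv.prodComm ℕ ℕ).tsum_eq]
        have hs : Summable fun r : ℕ × ℕ => H r.swap * δ r.1 := by
          refine Summable.of_norm_bounded ((Equiv.prodComm ℕ ℕ).summable_iff.2 hHs).norm
            fun r => ?_
          simp only [comp_apply, Equiv.prodComm_apply, hδ]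
          split_ifs <;> simp
        simp only [Equiv.prodComm_apply, Prod.snd_swap]
        have hs0 : ∀ b ≠ β, ∑' c, H (b, c).swap * δ b = 0 := fun b hb => by simp [hδ, hb]
        rw [hs.tsum_prod, tsum_eq_single β hs0]
        simp [hδ]
      · have hfv : ∀ η n, f (update η v n) = f η := fun η n => by
          simp only [f, update_of_ne (Ne.symm hv)]
        simp only [q, hv, and_false, if_false, huv, condPair_eq_of_update_snd hfv]
        rw [tsum_mul_fst_eq_zero hHs (abs_condSite_le hfb u) hrow]
        simp
    by_contra hne
    have hq : HasSum q 0 := by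
      have := hTq.mul_right (∑' α, H (α, β))⁻¹
      simpa [mul_assoc, mul_inv_cancel₀ hne] using this
    have := congrFun ((hasSum_zero_iff_of_nonneg hq0).1 hq) (x, y)
    simp only [q, ne_eq, hxy, not_false_eq_true, and_self, if_true, Pi.zero_apply] at this
    exact hpxy.ne' this
  -- Test with the indicator of `η x = α`, `η y = β`. Any other pair of distinct sites has a member
  -- outside `{x, y}`, so its term vanishes by zero row or column sums.
  have hrel : ∀ x y : Site d, x ≠ y → ∀ α β, p x y * H (α, β) + p y x * H (β, α) = 0 := by
    intro x y hxy α β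
    let f : Config d → ℝ := fun η => if η x = α ∧ η y = β then 1 else 0
    have hfb : ∀ η, |f η| ≤ 1 := fun η => by simp only [f]; split_ifs <;> simp
    have hf : IsBoundedCylinder f := by
      refine ⟨⟨1, hfb⟩, {x, y}, fun η ζ h => ?_⟩
      simp only [f, h x (by simp), h y (by simp)]
    have hTf := hT f hf
    have hupd : ∀ v, v ≠ x → v ≠ y → ∀ η n, f (update η v n) = f η := fun v hvx hvy η n => by
      simp only [f, update_of_ne (Ne.symm hvx), update_of_ne (Ne.symm hvy)]
    have hne : (x, y) ≠ (y, x) := fun h => hxy (Prod.mk.inj h).1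
    have hfin := hasSum_sum_of_ne_finset_zero (L := .unconditional _) (s := {(x, y), (y, x)})
      (f := fun xy : Site d × Site d => p xy.1 xy.2 * (if xy.1 = xy.2 then 0 else
        ∑' q : ℕ × ℕ, H q * condPair μ f xy.1 xy.2 q.1 q.2)) (by
      rintro ⟨u, v⟩ huv
      simp only [Finset.mem_insert, Finset.mem_singleton, Prod.mk.injEq, not_or] at huv
      dsimp only
      by_cases huv' : u = v
      · simp [huv']
      rw [if_neg huv']
      by_cases hv : v ≠ x ∧ v ≠ y
      · simp only [condPair_eq_of_update_snd (hupd v hv.1 hv.2)]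
        rw [tsum_mul_fst_eq_zero hHs (abs_condSite_le hfb u) hrow, mul_zero]
      have hu : u ≠ x ∧ u ≠ y := by
        by_contra hu
        have h1 : v = x ∨ v = y := by tauto
        have h2 : u = x ∨ u = y := by tauto
        rcases h1 with h1 | h1 <;> rcases h2 with h2 | h2 <;> subst h1 <;> simp_all
      simp only [condPair_eq_of_update_fst huv' (hupd u hu.1 hu.2)]
      rw [← (Equiv.prodComm ℕ ℕ).tsum_eq]
      have := tsum_mul_fst_eq_zero ((Equiv.prodComm ℕ ℕ).summable_iff.2 hHs)
        (abs_condSite_le (μ := μ) hfb v) hcol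
      simp only [comp_apply, Equiv.prodComm_apply] at this
      simp [this])
    have h0 := hfin.unique hTf
    rw [Finset.sum_pair hne] at h0
    simp only [hxy, Ne.symm hxy, if_false] at h0
    have e1 : ∀ γ δ : ℕ, condPair μ f x y γ δ = if (γ, δ) = (α, β) then 1 else 0 := fun γ δ => by
      simp [condPair, f, hxy]
    have e2 : ∀ γ δ : ℕ, condPair μ f y x γ δ = if (γ, δ) = (β, α) then 1 else 0 := fun γ δ => by
      simp [condPair_comm f hxy.symm, e1, and_comm]
    simpa only [e1, e2, Prod.mk.eta, mul_ite, mul_one, mul_zero, tsum_ite_eq] using h0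
  refine ⟨θ, ?_⟩
  by_cases hsymm : ∀ x y, p x y = p y x
  · right
    refine ⟨hsymm, fun q => ?_⟩
    obtain ⟨x, y, hxy, hpxy⟩ := hpos
    have := hrel x y hxy q.1 q.2
    rw [hsymm y x, ← mul_add] at this
    have := (mul_eq_zero.1 this).resolve_left hpxy.ne'
    change H (q.2, q.1) = - H (q.1, q.2)
    linarith
  · left
    push Not at hsymm
    obtain ⟨x, y, hne⟩ := hsymm
    have hxy : x ≠ y := by rintro rfl; exact hne rfl
    rintro ⟨α, β⟩
    change H (α, β) = 0
    have h1 := hrel x y hxy α β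
    have h2 := hrel x y hxy β α
    -- The two relations form a linear system in `H (α, β)`, `H (β, α)` with determinant `p(x,y)² -
    -- p(y,x)²`.
    have h3 : (p x y - p y x) * (p x y + p y x) * H (α, β) = 0 := by
      linear_combination p x y * h1 - p y x * h2
    have h4 : p x y + p y x ≠ 0 := by
      intro h
      have := hp.nonneg x y
      have := hp.nonneg y x
      exact hne (by linarith)
    exact (mul_eq_zero.1 h3).resolve_left (mul_ne_zero (sub_ne_zero.2 hne) h4)

end Necessity

/-! ### Exponential tilting -/

section Tilt

variable {μ : Measure ℕ} {φ : ℝ≥0}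

lemma tilt_singleton (μ : Measure ℕ) (φ : ℝ≥0) (n : ℕ) :
    tilt μ φ {n} = (partitionZ μ φ)⁻¹ * ((φ : ℝ≥0∞) ^ n * μ {n}) := by
  rw [tilt, Measure.smul_apply, withDensity_apply _ (measurableSet_singleton n),
    lintegral_singleton, smul_eq_mul]

lemma isProbabilityMeasure_tilt (h0 : partitionZ μ φ ≠ 0) (h1 : partitionZ μ φ ≠ ⊤) :
    IsProbabilityMeasure (tilt μ φ) := by
  refine ⟨?_⟩
  rw [tilt, Measure.smul_apply, withDensity_apply _ MeasurableSet.univ, Measure.restrict_univ,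
    lintegral_countable', smul_eq_mul]
  exact ENNReal.inv_mul_cancel h0 h1

lemma tilt_real_singleton (μ : Measure ℕ) (φ : ℝ≥0) (n : ℕ) :
    (tilt μ φ).real {n} = (partitionZ μ φ).toReal⁻¹ * (φ : ℝ) ^ n * μ.real {n} := by
  simp [measureReal_def, tilt_singleton, mul_assoc]

lemma tsum_mul_tilt (μ : Measure ℕ) (φ : ℝ≥0) :
    ∑' n : ℕ, (n : ℝ≥0∞) * tilt μ φ {n} = (partitionZ μ φ)⁻¹ * momentZ μ φ := by
  rw [momentZ, ← ENNReal.tsum_mul_left]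
  refine tsum_congr fun n => ?_
  rw [tilt_singleton]
  ring

/-- A jump conserves the number of particles of the pair, so gain and loss carry the same power of
`φ`. -/
lemma netFlux_geometric (g : ℕ → ℕ → ℕ → ℝ) (m : ℕ → ℝ) (c φ : ℝ) (q : ℕ × ℕ) :
    netFlux g (fun n => c * φ ^ n * m n) q = c ^ 2 * φ ^ (q.1 + q.2) * netFlux g m q := by
  simp only [netFlux, mul_sub, Finset.mul_sum]
  congr 1
  · refine Finset.sum_congr rfl fun k hk => ?_
    have : q.1 + q.2 = (q.1 + k) + (q.2 - k) := by
      have := (Finset.mem_Icc.1 hk).2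
      omega
    rw [this, pow_add φ (q.1 + k)]
    ring
  · rw [pow_add]
    ring

lemma fluxDefect_geometric (g : ℕ → ℕ → ℕ → ℝ) (m θ : ℕ → ℝ) (c φ : ℝ) (q : ℕ × ℕ) :
    fluxDefect g (fun n => c * φ ^ n * m n) (fun n => c * φ ^ n * θ n) q =
      c ^ 2 * φ ^ (q.1 + q.2) * fluxDefect g m θ q := by
  rw [fluxDefect, netFlux_geometric, fluxDefect, pow_add]
  ring

lemma generator_eq_zero {d : ℕ} (g : ℕ → ℕ → ℕ → ℝ) {p : Site d → Site d → ℝ}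
    (hp : ∀ x y, x ≠ y → p x y = 0) (f : Config d → ℝ) : generator g p f = 0 := by
  funext η
  rw [generator_eq]
  refine (tsum_congr fun xy => ?_).trans tsum_zero
  obtain ⟨x, y⟩ := xy
  by_cases h : x = y
  · subst h; simp [jumpTerm_self]
  · simp [hp x y h]

/-- If a product measure annihilates the generator, then so do its exponential tilts. -/
theorem AnnihilatesGenerator.tilt {d : ℕ} {g : ℕ → ℕ → ℕ → ℝ} (hg : IsRate g)
    [IsProbabilityMeasure μ] [IsProbabilityMeasure (tilt μ φ)]
    (hr : Integrable (pairRate g) (μ.prod μ))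
    (hr' : Integrable (pairRate g) ((MMP.tilt μ φ).prod (MMP.tilt μ φ)))
    {p : Site d → Site d → ℝ} (hp : IsTransition p)
    (hA : AnnihilatesGenerator g p (productMeasure d μ)) :
    AnnihilatesGenerator g p (productMeasure d (MMP.tilt μ φ)) := by
  -- If no jump changes the site, which irreducibility allows only for `d = 0`, the generator is
  -- zero.
  by_cases hpos : ∃ x y, x ≠ y ∧ 0 < p x y
  swap
  · have hp0 : ∀ x y, x ≠ y → p x y = 0 := fun x y hxy =>
      le_antisymm (not_lt.1 fun h => hpos ⟨x, y, hxy, h⟩) (hp.nonneg x y)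
    intro f _
    rw [generator_eq_zero g hp0 f]
    exact ⟨integrable_zero _ _ _, by simp⟩
  set c := (partitionZ μ φ).toReal⁻¹
  have em : (fun n => (MMP.tilt μ φ).real {n}) = fun n => c * (φ : ℝ) ^ n * μ.real {n} :=
    funext fun n => tilt_real_singleton μ φ n
  obtain ⟨θ, hθ⟩ := fluxDefect_of_annihilatesGenerator hg hr hp hpos hA
  rcases hθ with hθ | ⟨hsymm, hanti⟩
  · have h0 : ∀ q, fluxDefect g (fun n => (MMP.tilt μ φ).real {n})
        (fun n => c * (φ : ℝ) ^ n * θ n) q = 0 := fun q => by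
      rw [em, fluxDefect_geometric, hθ, mul_zero]
    refine annihilatesGenerator_of_fluxDefect hg hr' hp ?_ (Or.inl h0)
    -- For `φ > 1` the tilted potential need not inherit summability from `θ`. It is recovered from
    -- one column `β` of positive mass, where zero defect expresses it through the summable flux and
    -- weights.
    have hm := hasSum_real_singleton (MMP.tilt μ φ)
    obtain ⟨β, hβ⟩ : ∃ β, (MMP.tilt μ φ).real {β} ≠ 0 := by
      by_contra! h
      simp only [h] at hm
      exact zero_ne_one (hasSum_zero.unique hm)
    have hG := summable_netFlux hg (fun n => measureReal_nonneg (μ := MMP.tilt μ φ) (s := {n}))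
      (summable_weight_mul_pairRate hr' hg)
    have hcol : Summable fun α => netFlux g (fun n => (MMP.tilt μ φ).real {n}) (α, β) :=
      hG.comp_injective (i := fun α => (α, β)) fun a b h => (Prod.mk.inj h).1
    have hs := (hcol.add (hm.summable.mul_right (c * (φ : ℝ) ^ β * θ β))).mul_right
      ((MMP.tilt μ φ).real {β})⁻¹
    refine hs.congr fun α => ?_
    have := h0 (α, β)
    simp only [fluxDefect] at this
    field_simp
    linarith
  -- The gradient part is antisymmetric by itself, so `G` is antisymmetric and the potential can be
  -- taken to be zero.
  · have hG : ∀ q : ℕ × ℕ, netFlux g (fun n => μ.real {n}) q.swap =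
        -netFlux g (fun n => μ.real {n}) q := fun q => by
      have := hanti q
      simp only [fluxDefect, Prod.fst_swap, Prod.snd_swap] at this
      linarith
    refine annihilatesGenerator_of_fluxDefect hg hr' hp (θ := 0) summable_zero
      (Or.inr ⟨hsymm, fun q => ?_⟩)
    simp only [fluxDefect, Pi.zero_apply, zero_mul, mul_zero, sub_zero]
    rw [em, netFlux_geometric, netFlux_geometric, hG, Prod.fst_swap, Prod.snd_swap, add_comm q.2]
    ring

end Tilt

/-! ### Integrability of the jump rates -/

section Rates

variable {g : ℕ → ℕ → ℕ → ℝ} {μ : Measure ℕ} [IsProbabilityMeasure μ]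

lemma BoundedRates.integrable_pairRate (hb : BoundedRates g) (hg : IsRate g) :
    Integrable (pairRate g) (μ.prod μ) := by
  obtain ⟨C, -, hC⟩ := hb
  refine integrable_of_bounded (c := C) (measurable_of_countable _) fun q => ?_
  rw [abs_of_nonneg (hg.pairRate_nonneg q)]
  exact hC _ _

omit [IsProbabilityMeasure μ] in
lemma integrable_natCast (h : ∑' n : ℕ, (n : ℝ≥0∞) * μ {n} < ⊤) :
    Integrable (fun n : ℕ => (n : ℝ)) μ := by
  refine ⟨(measurable_of_countable _).aestronglyMeasurable, ?_⟩
  rw [HasFiniteIntegral, lintegral_countable']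
  simpa using h

lemma LinearGrowth.pairRate_le (hg : IsRate g) {C : ℝ} (hC0 : 0 < C)
    (hC : ∀ α β : ℕ, 0 < α →
      ∑ k ∈ Finset.Icc 1 α, (k : ℝ) * g k α β ≤ C * ((α : ℝ) + (β : ℝ))) (q : ℕ × ℕ) :
    pairRate g q ≤ C * (q.1 + q.2) := by
  rcases Nat.eq_zero_or_pos q.1 with h | h
  · simp only [pairRate, h]
    simp
    positivity
  · refine le_trans (Finset.sum_le_sum fun k hk => ?_) (hC q.1 q.2 h)
    exact le_mul_of_one_le_left (hg.nonneg _ _ _) (by exact_mod_cast (Finset.mem_Icc.1 hk).1)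

lemma LinearGrowth.integrable_pairRate (hl : LinearGrowth g) (hg : IsRate g)
    (h : ∑' n : ℕ, (n : ℝ≥0∞) * μ {n} < ⊤) : Integrable (pairRate g) (μ.prod μ) := by
  obtain ⟨C, hC0, hC⟩ := hl
  have hi := integrable_natCast h
  have hi2 : Integrable (fun q : ℕ × ℕ => C * ((q.1 : ℝ) + q.2)) (μ.prod μ) :=
    ((hi.comp_fst μ).add (hi.comp_snd μ)).const_mul C
  refine hi2.mono' (measurable_of_countable _).aestronglyMeasurable (ae_of_all _ fun q => ?_)
  rw [Real.norm_of_nonneg (hg.pairRate_nonneg q)]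
  exact LinearGrowth.pairRate_le hg hC0 hC q

end Rates

/-! ### Lipschitz functions and cylinder approximation -/

section Lipschitz

variable {d : ℕ} {a : Site d → ℝ} (ha : ∀ x, 0 < a x)

lemma jump_sub_eq_zero (x y : Site d) (k : ℕ) (η : Config d) {z : Site d}
    (hx : z ≠ x) (hy : z ≠ y) : (jump x y k η z : ℝ) - η z = 0 := by
  simp [jump, hx, hy]

lemma jump_mem_configSpace (x y : Site d) (k : ℕ) {η : Config d} (hη : η ∈ configSpace a) :
    jump x y k η ∈ configSpace a := by
  have h : Summable fun z => ((jump x y k η z : ℝ) - η z) * a z := by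
    refine summable_of_ne_finset_zero (s := {x, y}) fun z hz => ?_
    simp only [Finset.mem_insert, Finset.mem_singleton, not_or] at hz
    rw [jump_sub_eq_zero x y k η hz.1 hz.2, zero_mul]
  refine (Summable.add hη h).congr fun z => ?_
  ring

include ha

lemma summable_jump_dist (x y : Site d) (k : ℕ) (η : Config d) :
    Summable (fun z => |(jump x y k η z : ℝ) - η z| * a z) ∧
    ∑' z, |(jump x y k η z : ℝ) - η z| * a z ≤ k * (a x + a y) := by
  have h0 : ∀ z ∉ ({x, y} : Finset (Site d)), |(jump x y k η z : ℝ) - η z| * a z = 0 := by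
    intro z hz
    simp only [Finset.mem_insert, Finset.mem_singleton, not_or] at hz
    rw [jump_sub_eq_zero x y k η hz.1 hz.2, abs_zero, zero_mul]
  have hk : (0 : ℝ) ≤ k := Nat.cast_nonneg k
  refine ⟨summable_of_ne_finset_zero h0, ?_⟩
  rw [tsum_eq_sum h0]
  have hpos : 0 ≤ (k : ℝ) * (a x + a y) := mul_nonneg hk (add_pos (ha x) (ha y)).le
  by_cases hkx : k ≤ η x
  swap
  · simpa [jump, hkx] using hpos
  by_cases hxy : x = y
  · subst hxy
    simpa [jump_self x hkx] using hpos
  rw [Finset.sum_pair hxy, jump_eq_update hxy hkx]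
  simp only [update_of_ne hxy, update_self, Nat.cast_sub hkx, Nat.cast_add]
  rw [sub_sub_cancel_left, abs_neg, add_sub_cancel_left, abs_of_nonneg hk, mul_add]

lemma IsLipschitz.abs_jump_sub_le {K : ℝ} {f : Config d → ℝ}
    (hf : IsLipschitz a (configSpace a) K f) (x y : Site d) (k : ℕ) {η : Config d}
    (hη : η ∈ configSpace a) : |f (jump x y k η) - f η| ≤ K * (k * (a x + a y)) := by
  obtain ⟨hs, hle⟩ := summable_jump_dist ha x y k η
  exact (hf.2.2 _ (jump_mem_configSpace x y k hη) _ hη hs).trans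
    (mul_le_mul_of_nonneg_left hle hf.2.1)

/-- Occupation numbers are integers: configurations that differ at `z ∈ V` are at distance at least
`a z`, while `f` oscillates by at most `2 * c`. -/
lemma IsBoundedCylinder.isLipschitz {f : Config d → ℝ} (hf : IsBoundedCylinder f)
    (Ω : Set (Config d)) : ∃ K, IsLipschitz a Ω K f := by
  have hfm := hf.measurable
  obtain ⟨⟨c, hc⟩, V, hV⟩ := hf
  have hc0 : 0 ≤ c := (abs_nonneg _).trans (hc 0)
  have hterm : ∀ z ∈ V, 0 ≤ 2 * c / a z := fun z _ => div_nonneg (by linarith) (ha z).le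
  refine ⟨∑ z ∈ V, 2 * c / a z, hfm, Finset.sum_nonneg hterm, fun η _ ζ _ hs => ?_⟩
  have hnn : ∀ z, 0 ≤ |(η z : ℝ) - ζ z| * a z := fun z => mul_nonneg (abs_nonneg _) (ha z).le
  by_cases hag : ∀ z ∈ V, η z = ζ z
  · rw [hV hag, sub_self, abs_zero]
    exact mul_nonneg (Finset.sum_nonneg hterm) (tsum_nonneg hnn)
  push Not at hag
  obtain ⟨z, hz, hne⟩ := hag
  have h1 : 1 ≤ |(η z : ℝ) - ζ z| := by
    have : (1 : ℤ) ≤ |(η z : ℤ) - ζ z| := Int.one_le_abs (by omega)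
    exact_mod_cast this
  have h2 : a z ≤ ∑' z, |(η z : ℝ) - ζ z| * a z :=
    (le_mul_of_one_le_left (ha z).le h1).trans (hs.le_tsum z fun w _ => hnn w)
  calc |f η - f ζ| ≤ 2 * c := (abs_sub _ _).trans (by linarith [hc η, hc ζ])
    _ = 2 * c / a z * a z := (div_mul_cancel₀ _ (ha z).ne').symm
    _ ≤ _ := mul_le_mul (Finset.single_le_sum hterm hz) h2 (ha z).le (Finset.sum_nonneg hterm)

omit ha in
/-- The restriction of a configuration to a finite set of sites. -/
def cut (V : Finset (Site d)) (η : Config d) : Config d := fun z => if z ∈ V then η z else 0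

omit ha in
lemma cut_mem_configSpace (V : Finset (Site d)) (η : Config d) : cut V η ∈ configSpace a :=
  summable_of_ne_finset_zero (s := V) fun z hz => by simp [cut, hz]

omit ha in
lemma isBoundedCylinder_comp_cut {f : Config d → ℝ} {c : ℝ} (hc : ∀ η, |f η| ≤ c)
    (V : Finset (Site d)) : IsBoundedCylinder fun η => f (cut V η) := by
  refine ⟨⟨c, fun _ => hc _⟩, V, fun η ζ h => ?_⟩
  dsimp only
  congr 1
  funext z
  by_cases hz : z ∈ V
  · simp [cut, hz, h z hz]
  · simp [cut, hz]

lemma IsLipschitz.comp_cut {K : ℝ} {f : Config d → ℝ}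
    (hf : IsLipschitz a (configSpace a) K f) (V : Finset (Site d)) :
    IsLipschitz a (configSpace a) K fun η => f (cut V η) := by
  refine ⟨hf.1.comp ?_, hf.2.1, fun η _ ζ _ hs => ?_⟩
  · refine measurable_pi_lambda _ fun z => ?_
    unfold cut
    split_ifs
    exacts [measurable_pi_apply z, measurable_const]
  · have hle : ∀ z, |(cut V η z : ℝ) - cut V ζ z| * a z ≤ |(η z : ℝ) - ζ z| * a z := fun z => by
      by_cases hz : z ∈ V
      · simp [cut, hz]
      · simpa [cut, hz] using mul_nonneg (abs_nonneg _) (ha z).le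
    have hs' := Summable.of_nonneg_of_le (fun z => mul_nonneg (abs_nonneg _) (ha z).le) hle hs
    exact (hf.2.2 _ (cut_mem_configSpace V η) _ (cut_mem_configSpace V ζ) hs').trans
      (mul_le_mul_of_nonneg_left (hs'.tsum_le_tsum hle hs) hf.2.1)

lemma IsLipschitz.tendsto_comp_cut {K : ℝ} {f : Config d → ℝ}
    (hf : IsLipschitz a (configSpace a) K f) {η : Config d} (hη : η ∈ configSpace a) :
    Tendsto (fun V => f (cut V η)) atTop (𝓝 (f η)) := by
  have hle : ∀ V z, |(cut V η z : ℝ) - η z| * a z ≤ η z * a z := fun V z => by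
    refine mul_le_mul_of_nonneg_right ?_ (ha z).le
    by_cases hz : z ∈ V <;> simp [cut, hz]
  have hnn : ∀ V z, 0 ≤ |(cut V η z : ℝ) - η z| * a z := fun V z =>
    mul_nonneg (abs_nonneg _) (ha z).le
  have hlim : Tendsto (fun V => ∑' z, |(cut V η z : ℝ) - η z| * a z) atTop (𝓝 0) := by
    rw [← tsum_zero (β := Site d) (α := ℝ)]
    refine tendsto_tsum_of_dominated_convergence (bound := fun z => η z * a z) hη (fun z => ?_)
      (Eventually.of_forall fun V z => by rw [Real.norm_of_nonneg (hnn V z)]; exact hle V z)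
    refine tendsto_const_nhds.congr' ?_
    filter_upwards [eventually_ge_atTop {z}] with V hV
    simp [cut, Finset.singleton_subset_iff.1 hV]
  rw [tendsto_iff_norm_sub_tendsto_zero]
  refine squeeze_zero (fun _ => norm_nonneg _) (fun V => ?_) (by simpa using hlim.const_mul K)
  exact hf.2.2 _ (cut_mem_configSpace V η) _ hη
    (Summable.of_nonneg_of_le (hnn V) (hle V) hη)

end Lipschitz

/-! ### A uniform bound for the generator on Lipschitz functions -/

section Bound

variable {d : ℕ} {g : ℕ → ℕ → ℕ → ℝ} {p : Site d → Site d → ℝ} {a : Site d → ℝ} {C : ℝ}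

/-- Up to the Lipschitz constant of `f`, a bound for the contribution of the jumps from `x` to `y`
to `ℒ f`. -/
def jumpBound (C : ℝ) (p : Site d → Site d → ℝ) (a : Site d → ℝ) (xy : Site d × Site d)
    (η : Config d) : ℝ :=
  p xy.1 xy.2 * (C * ((η xy.1 : ℝ) + η xy.2) * (a xy.1 + a xy.2))

variable (hg : IsRate g) (hp : IsTransition p) (ha : ∀ x, 0 < a x) (hC0 : 0 < C)
  (hC : ∀ α β : ℕ, 0 < α → ∑ k ∈ Finset.Icc 1 α, (k : ℝ) * g k α β ≤ C * ((α : ℝ) + (β : ℝ)))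

include hp ha hC0 in
lemma jumpBound_nonneg (xy : Site d × Site d) (η : Config d) : 0 ≤ jumpBound C p a xy η :=
  mul_nonneg (hp.nonneg _ _) (mul_nonneg (mul_nonneg hC0.le (by positivity))
    (add_pos (ha _) (ha _)).le)

include hg hp ha hC0 hC

lemma IsLipschitz.abs_jumpTerm_le {K : ℝ} {f : Config d → ℝ}
    (hf : IsLipschitz a (configSpace a) K f) {η : Config d} (hη : η ∈ configSpace a)
    (xy : Site d × Site d) :
    |p xy.1 xy.2 * jumpTerm g f xy.1 xy.2 η| ≤ K * jumpBound C p a xy η := by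
  obtain ⟨x, y⟩ := xy
  dsimp only [jumpBound]
  rw [abs_mul, abs_of_nonneg (hp.nonneg _ _), mul_left_comm]
  refine mul_le_mul_of_nonneg_left ?_ (hp.nonneg _ _)
  have hA := add_pos (ha x) (ha y)
  have h1 : ∑ k ∈ Finset.Icc 1 (η x), (k : ℝ) * g k (η x) (η y) ≤ C * ((η x : ℝ) + η y) := by
    rcases Nat.eq_zero_or_pos (η x) with h | h
    · rw [h]; simp; positivity
    · exact hC _ _ h
  calc |jumpTerm g f x y η|
      ≤ ∑ k ∈ Finset.Icc 1 (η x), (k : ℝ) * g k (η x) (η y) * (K * (a x + a y)) := by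
        refine (Finset.abs_sum_le_sum_abs _ _).trans (Finset.sum_le_sum fun k _ => ?_)
        rw [abs_mul, abs_of_nonneg (hg.nonneg _ _ _)]
        refine (mul_le_mul_of_nonneg_left (hf.abs_jump_sub_le ha x y k hη)
          (hg.nonneg _ _ _)).trans (le_of_eq ?_)
        ring
    _ ≤ C * ((η x : ℝ) + η y) * (K * (a x + a y)) := by
        rw [← Finset.sum_mul]
        exact mul_le_mul_of_nonneg_right h1 (mul_nonneg hf.2.1 hA.le)
    _ = _ := by ring

lemma IsLipschitz.abs_generator_le {K : ℝ} {f : Config d → ℝ}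
    (hf : IsLipschitz a (configSpace a) K f) {η : Config d} (hη : η ∈ configSpace a)
    (hs : Summable fun xy => jumpBound C p a xy η) :
    |generator g p f η| ≤ K * ∑' xy, jumpBound C p a xy η := by
  rw [generator_eq, ← Real.norm_eq_abs]
  exact tsum_of_norm_bounded (hs.hasSum.mul_left K)
    fun xy => hf.abs_jumpTerm_le hg hp ha hC0 hC hη xy

lemma IsLipschitz.tendsto_generator_comp_cut {K : ℝ} {f : Config d → ℝ}
    (hf : IsLipschitz a (configSpace a) K f) {η : Config d} (hη : η ∈ configSpace a)
    (hs : Summable fun xy => jumpBound C p a xy η) :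
    Tendsto (fun V => generator g p (fun ζ => f (cut V ζ)) η) atTop (𝓝 (generator g p f η)) := by
  simp_rw [generator_eq]
  refine tendsto_tsum_of_dominated_convergence (hs.mul_left K) (fun xy => ?_)
    (Eventually.of_forall fun V xy => (hf.comp_cut ha V).abs_jumpTerm_le hg hp ha hC0 hC hη xy)
  refine Tendsto.const_mul _ (tendsto_finsetSum _ fun k _ => Tendsto.const_mul _ ?_)
  exact (hf.tendsto_comp_cut ha (jump_mem_configSpace _ _ _ hη)).sub (hf.tendsto_comp_cut ha hη)

end Bound

/-! ### Product measures with finite first moment -/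

section Moment

variable {d : ℕ} {p : Site d → Site d → ℝ} {a : Site d → ℝ} {C : ℝ} {μ : Measure ℕ}
  [IsProbabilityMeasure μ] (hμ : Integrable (fun n : ℕ => (n : ℝ)) μ)

include hμ

lemma integrable_eval (x : Site d) :
    Integrable (fun η : Config d => (η x : ℝ)) (productMeasure d μ) :=
  (measurePreserving_eval μ x).integrable_comp_of_integrable hμ

omit hμ in
lemma integral_eval (x : Site d) :
    ∫ η : Config d, (η x : ℝ) ∂(productMeasure d μ) = ∫ n : ℕ, (n : ℝ) ∂μ := by
  have h := measurePreserving_eval (d := d) μ x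
  conv_rhs => rw [← h.map_eq]
  rw [integral_map h.aemeasurable (measurable_of_countable _).aestronglyMeasurable]

lemma ae_mem_configSpace (ha : ∀ x, 0 < a x) (has : Summable a) :
    ∀ᵐ η ∂(productMeasure d μ), η ∈ configSpace a := by
  refine (ae_summable_of_summable_integral (F := fun x (η : Config d) => (η x : ℝ) * a x)
    (fun x η => mul_nonneg (Nat.cast_nonneg _) (ha x).le)
    (fun x => (integrable_eval hμ x).mul_const _) ?_).1
  simp_rw [integral_mul_const, integral_eval]
  exact has.mul_left _

/-- The expected bounds are `2 C E[n] p(x,y) (a x + a y)`, which are summable by double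
stochasticity. This is the dominating function for every limit below. -/
lemma ae_summable_jumpBound (hp : IsTransition p) (ha : ∀ x, 0 < a x) (has : Summable a)
    (hC0 : 0 < C) :
    (∀ᵐ η ∂(productMeasure d μ), Summable fun xy => jumpBound C p a xy η) ∧
    Integrable (fun η => ∑' xy, jumpBound C p a xy η) (productMeasure d μ) := by
  refine ae_summable_of_summable_integral (jumpBound_nonneg hp ha hC0) (fun xy => ?_) ?_
  · exact ((((integrable_eval hμ _).add (integrable_eval hμ _)).const_mul C).mul_const _).const_mul _
  · have hs := (((hp.hasSum_mul_fst has).add (hp.hasSum_mul_snd has)).summable.mul_right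
      (C * (∫ n : ℕ, (n : ℝ) ∂μ + ∫ n : ℕ, (n : ℝ) ∂μ)))
    refine hs.congr fun xy => ?_
    simp only [jumpBound]
    rw [integral_const_mul, integral_mul_const, integral_const_mul,
      integral_add (integrable_eval hμ _) (integrable_eval hμ _), integral_eval, integral_eval]
    ring

end Moment

/-! ### Invariance versus annihilation of the generator under (S) -/

section Semigroup

variable {d : ℕ} {g : ℕ → ℕ → ℕ → ℝ} {p : Site d → Site d → ℝ} {a : Site d → ℝ}
  {P : ℝ≥0 → Kernel (Config d) (Config d)} {μ : Measure ℕ} [IsProbabilityMeasure μ]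

lemma abs_semigroup_le [∀ t, IsMarkovKernel (P t)] {f : Config d → ℝ} {c : ℝ}
    (hc : ∀ η, |f η| ≤ c) (t : ℝ≥0) (η : Config d) : |semigroup P t f η| ≤ c :=
  abs_integral_le_of_abs_le hc

/-- The generator has zero mean on bounded Lipschitz functions if it has zero mean on bounded
cylinder functions. -/
lemma AnnihilatesGenerator.integral_generator_eq_zero (hg : IsRate g) (hp : IsTransition p)
    (ha : IsWeight p a) (hl : LinearGrowth g) (hμ : Integrable (fun n : ℕ => (n : ℝ)) μ)
    (hA : AnnihilatesGenerator g p (productMeasure d μ)) {K c : ℝ} {f : Config d → ℝ}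
    (hf : IsLipschitz a (configSpace a) K f) (hc : ∀ η, |f η| ≤ c) :
    ∫ η, generator g p f η ∂(productMeasure d μ) = 0 := by
  obtain ⟨C, hC0, hC⟩ := hl
  have hX := ae_mem_configSpace (d := d) hμ ha.pos ha.summable
  obtain ⟨hB, hBi⟩ := ae_summable_jumpBound hμ hp ha.pos ha.summable hC0
  have hlim := tendsto_integral_filter_of_dominated_convergence (μ := productMeasure d μ)
    (l := (atTop : Filter (Finset (Site d))))
    (F := fun V η => generator g p (fun ζ => f (cut V ζ)) η) (f := generator g p f)
    (fun η => K * ∑' xy, jumpBound C p a xy η)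
    (Eventually.of_forall fun V =>
      (measurable_generator (hf.comp_cut ha.pos V).1 p).aestronglyMeasurable)
    (Eventually.of_forall fun V => by
      filter_upwards [hX, hB] with η h1 h2
      exact (hf.comp_cut ha.pos V).abs_generator_le hg hp ha.pos hC0 hC h1 h2)
    (hBi.const_mul K)
    (by
      filter_upwards [hX, hB] with η h1 h2
      exact hf.tendsto_generator_comp_cut hg hp ha.pos hC0 hC h1 h2)
  simp_rw [fun V => (hA _ (isBoundedCylinder_comp_cut hc V)).2] at hlim
  exact tendsto_nhds_unique hlim tendsto_const_nhds

/-- Invariant product measures with finite first moment annihilate the generator. -/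
theorem IsInvariant.annihilatesGenerator (hg : IsRate g) (hp : IsTransition p)
    (ha : IsWeight p a) (hP : IsProcess g p (configSpace a) P)
    (hS : GeneratedOnLipschitz g p a P) (hl : LinearGrowth g)
    (hμ : ∑' n : ℕ, (n : ℝ≥0∞) * μ {n} < ⊤)
    (hinv : IsInvariant a (configSpace a) P (productMeasure d μ)) :
    AnnihilatesGenerator g p (productMeasure d μ) := by
  intro f hf
  refine ⟨(hasSum_integral_generator hg (hl.integrable_pairRate hg hμ) hp hf).1, ?_⟩
  have := hP.markov
  obtain ⟨K, hK⟩ := hf.isLipschitz ha.pos (configSpace a)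
  obtain ⟨m, hm⟩ := hf.1
  obtain ⟨C, hC0, hC⟩ := hl
  obtain ⟨c, hc0, hc⟩ := hS.lipschitz
  have hμi := integrable_natCast hμ
  have hX := ae_mem_configSpace (d := d) hμi ha.pos ha.summable
  obtain ⟨hB, hBi⟩ := ae_summable_jumpBound hμi hp ha.pos ha.summable hC0
  have hmeas : ∀ t, Measurable (semigroup P t f) := fun t => (hc K f hK t).1
  have hzero : ∀ t : ℝ≥0, ∫ η, (semigroup P t f η - f η) / (t : ℝ) ∂(productMeasure d μ) = 0 := by
    intro t
    rw [integral_div, integral_sub (integrable_of_bounded (hmeas t) (abs_semigroup_le hm t))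
      (integrable_of_bounded hf.measurable hm), hinv.2.2 K f hK ⟨m, hm⟩ t, sub_self, zero_div]
  -- For `t ≤ 1` the Lipschitz constants of `S(s) f`, `s ≤ t`, are at most `K * exp c`, so the
  -- backward equation dominates the difference quotients uniformly.
  have hsmall : ∀ᶠ t : ℝ≥0 in 𝓝[>] 0, 0 < t ∧ t ≤ 1 :=
    (eventually_mem_nhdsWithin).and (nhdsWithin_le_nhds (eventually_le_nhds zero_lt_one))
  have hlim := tendsto_integral_filter_of_dominated_convergence (μ := productMeasure d μ)
    (l := 𝓝[>] (0 : ℝ≥0)) (F := fun t η => (semigroup P t f η - f η) / (t : ℝ))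
    (f := generator g p f)
    (fun η => K * Real.exp c * ∑' xy, jumpBound C p a xy η)
    (Eventually.of_forall fun t => (((hmeas t).sub hf.measurable).div_const _).aestronglyMeasurable)
    (by
      filter_upwards [hsmall] with t ht
      filter_upwards [hX, hB] with η h1 h2
      have ht0 : (0 : ℝ) < t := ht.1
      rw [(hS.backward K f hK t η h1).2, add_sub_cancel_left, norm_div,
        Real.norm_of_nonneg ht0.le, div_le_iff₀ ht0]
      refine (intervalIntegral.norm_integral_le_of_norm_le_const
        (C := K * Real.exp c * ∑' xy, jumpBound C p a xy η) fun s hs => ?_).trans_eq (by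
          rw [sub_zero, abs_of_pos ht0])
      rw [Set.uIoc_of_le ht0.le] at hs
      have hs1 : s ≤ 1 := hs.2.trans (by exact_mod_cast ht.2)
      refine ((hc K f hK s.toNNReal).abs_generator_le hg hp ha.pos hC0 hC h1 h2).trans ?_
      refine mul_le_mul_of_nonneg_right (mul_le_mul_of_nonneg_left ?_ hK.2.1)
        (tsum_nonneg fun xy => jumpBound_nonneg hp ha.pos hC0 xy η)
      rw [Real.exp_le_exp, Real.coe_toNNReal _ hs.1.le]
      exact mul_le_of_le_one_right hc0.le hs1)
    (hBi.const_mul _)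
    (by
      filter_upwards [hX] with η h1
      exact hP.hasGenerator f hf η h1)
  simp_rw [hzero] at hlim
  exact (tendsto_nhds_unique hlim tendsto_const_nhds)

/-- Product measures with finite first moment that annihilate the generator are invariant. -/
theorem AnnihilatesGenerator.isInvariant (hg : IsRate g) (hp : IsTransition p)
    (ha : IsWeight p a) (hP : IsProcess g p (configSpace a) P)
    (hS : GeneratedOnLipschitz g p a P) (hl : LinearGrowth g)
    (hμ : ∑' n : ℕ, (n : ℝ≥0∞) * μ {n} < ⊤)
    (hA : AnnihilatesGenerator g p (productMeasure d μ)) :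
    IsInvariant a (configSpace a) P (productMeasure d μ) := by
  classical
  have hμi := integrable_natCast hμ
  have hX := ae_mem_configSpace (d := d) hμi ha.pos ha.summable
  refine ⟨inferInstance, hX, ?_⟩
  rintro K f hf ⟨m, hm⟩ t
  have := hP.markov
  obtain ⟨c, hc0, hc⟩ := hS.lipschitz
  have hmeas : ∀ s, Measurable (semigroup P s f) := fun s => (hc K f hf s).1
  -- Off the state space the kernels are arbitrary; setting `u` to zero there gives continuity in
  -- `s` for every `η`, hence joint measurability. Jumps stay in `configSpace a`, so `ℒ` is
  -- unaffected on it.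
  let u : ℝ → Config d → ℝ := fun s η =>
    if η ∈ configSpace a then semigroup P s.toNNReal f η else 0
  have hu : Measurable (uncurry u) := by
    refine measurable_uncurry_of_continuous_of_measurable (fun η => ?_)
      fun s => Measurable.ite hP.measurableSet (hmeas _) measurable_const
    by_cases hη : η ∈ configSpace a
    swap
    · simpa only [u, hη, if_false] using continuous_const
    simp only [u, hη, if_true]
    have hcont : ContinuousOn (fun s : ℝ => semigroup P s.toNNReal f η) (Set.Ici 0) := by
      intro s hs
      -- The horizon `s + 1` makes `[0, s + 1]` a neighbourhood of `s` within `[0, ∞)`.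
      have h1 := (hS.backward K f hf (s.toNNReal + 1) η hη).1
      have h2 := (intervalIntegral.continuousOn_primitive_interval' h1 Set.left_mem_uIcc)
      have hs0 : 0 ≤ s := hs
      have hcoe : ((s.toNNReal + 1 : ℝ≥0) : ℝ) = s + 1 := by
        rw [NNReal.coe_add, Real.coe_toNNReal s hs0, NNReal.coe_one]
      rw [hcoe, Set.uIcc_of_le (by linarith)] at h2
      have h3 := (h2 s ⟨hs0, by linarith⟩).const_add (f η)
      have h4 : ContinuousWithinAt (fun s : ℝ => semigroup P s.toNNReal f η)
          (Set.Icc 0 (s + 1)) s := by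
        refine h3.congr (fun r hr => ?_) ?_
        · rw [(hS.backward K f hf r.toNNReal η hη).2, Real.coe_toNNReal r hr.1]
        · rw [(hS.backward K f hf s.toNNReal η hη).2, Real.coe_toNNReal s hs0]
      refine h4.mono_of_mem_nhdsWithin ?_
      filter_upwards [self_mem_nhdsWithin,
        nhdsWithin_le_nhds (Iic_mem_nhds (show s < s + 1 by linarith))] with r h1 h2
      exact ⟨h1, h2⟩
    have h5 := hcont.comp_continuous (f := fun s : ℝ => max s 0)
      (continuous_id.max continuous_const) fun s =>
      Set.mem_Ici.2 (le_max_right _ _)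
    convert h5 using 2 with s
    simp only [comp_apply]
    congr 1
    exact NNReal.eq (by simp)
  obtain ⟨C, hC0, hC⟩ := id hl
  obtain ⟨hB, hBi⟩ := ae_summable_jumpBound hμi hp ha.pos ha.summable hC0
  have hgen : ∀ s η, η ∈ configSpace a →
      generator g p (u s) η = generator g p (semigroup P s.toNNReal f) η := by
    intro s η hη
    simp only [generator, u, hη, jump_mem_configSpace, if_true]
  have hint : Integrable (uncurry fun s η => generator g p (u s) η)
      ((volume.restrict (Set.uIoc 0 (t : ℝ))).prod (productMeasure d μ)) := by
    have : IsFiniteMeasure (volume.restrict (Set.uIoc 0 (t : ℝ))) := by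
      rw [Set.uIoc_of_le t.coe_nonneg]
      infer_instance
    refine ((hBi.const_mul (K * Real.exp (c * t))).comp_snd
      (volume.restrict (Set.uIoc 0 (t : ℝ)))).mono'
      (measurable_uncurry_generator hu p).aestronglyMeasurable ?_
    have e1 : ∀ᵐ q ∂(volume.restrict (Set.uIoc 0 (t : ℝ))).prod (productMeasure d μ),
        q.1 ∈ Set.uIoc 0 (t : ℝ) :=
      Measure.quasiMeasurePreserving_fst.ae (ae_restrict_mem measurableSet_uIoc)
    have e2 : ∀ᵐ q ∂(volume.restrict (Set.uIoc 0 (t : ℝ))).prod (productMeasure d μ),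
        q.2 ∈ configSpace a ∧ Summable fun xy => jumpBound C p a xy q.2 :=
      Measure.quasiMeasurePreserving_snd.ae (hX.and hB)
    filter_upwards [e1, e2] with ⟨s, η⟩ h1 h2
    dsimp only [uncurry] at h1 h2 ⊢
    rw [Set.uIoc_of_le t.coe_nonneg] at h1
    rw [hgen s η h2.1]
    refine ((hc K f hf s.toNNReal).abs_generator_le hg hp ha.pos hC0 hC h2.1 h2.2).trans ?_
    refine mul_le_mul_of_nonneg_right (mul_le_mul_of_nonneg_left ?_ hf.2.1)
      (tsum_nonneg fun xy => jumpBound_nonneg hp ha.pos hC0 xy η)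
    rw [Real.exp_le_exp, Real.coe_toNNReal _ h1.1.le]
    exact mul_le_mul_of_nonneg_left h1.2 hc0.le
  -- By Fubini, `∫ (S(t) f - f)` is the time integral of `∫ ℒ S(s) f`, which vanishes as each `S(s)
  -- f` is bounded and Lipschitz.
  have hswap := intervalIntegral_integral_swap hint
  have hzero : ∀ s, ∫ η, generator g p (u s) η ∂(productMeasure d μ) = 0 := fun s => by
    rw [← hA.integral_generator_eq_zero hg hp ha hl hμi (hc K f hf s.toNNReal)
      (abs_semigroup_le hm _)]
    refine integral_congr_ae ?_
    filter_upwards [hX] with η hη using hgen s η hη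
  simp only [hzero, intervalIntegral.integral_zero] at hswap
  rw [← sub_eq_zero, ← integral_sub (integrable_of_bounded (hmeas t) (abs_semigroup_le hm t))
    (integrable_of_bounded hf.1 hm), hswap]
  refine integral_congr_ae ?_
  filter_upwards [hX] with η hη
  rw [(hS.backward K f hf t η hη).2, add_sub_cancel_left]
  exact intervalIntegral.integral_congr fun s _ => (hgen s η hη).symm

end Semigroup

/-! ### Radius of convergence and moments -/

section Fugacity

variable {μ : Measure ℕ} [IsProbabilityMeasure μ] {φ : ℝ≥0}

lemma one_le_criticalFugacity : 1 ≤ criticalFugacity μ := by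
  have := FormalMultilinearSeries.le_radius_of_bound
    (FormalMultilinearSeries.ofScalars ℝ (fun n : ℕ => μ.real {n})) (r := 1) 1 fun n => by
      rw [FormalMultilinearSeries.ofScalars_norm, Real.norm_of_nonneg measureReal_nonneg]
      simp
  exact_mod_cast this

lemma partitionZ_lt_top_of_momentZ (h : momentZ μ φ < ⊤) : partitionZ μ φ < ⊤ := by
  have hle : partitionZ μ φ ≤ μ {0} + momentZ μ φ := by
    rw [partitionZ, momentZ, tsum_eq_zero_add' ENNReal.summable,
      tsum_eq_zero_add' (f := fun n : ℕ => (n : ℝ≥0∞) * (φ : ℝ≥0∞) ^ n * μ {n}) ENNReal.summable]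
    simp only [pow_zero, one_mul, Nat.cast_zero, zero_mul, zero_add]
    refine add_le_add le_rfl (ENNReal.tsum_le_tsum fun n => ?_)
    rw [mul_assoc]
    refine le_mul_of_one_le_left zero_le ?_
    exact_mod_cast Nat.le_add_left 1 n
  exact hle.trans_lt (ENNReal.add_lt_top.2 ⟨measure_lt_top _ _, h⟩)

/-- For `r` strictly between `φ` and the radius, `μ(n) r^n` is bounded, and `∑ n (φ/r)^n` converges.
-/
lemma momentZ_lt_top (h : (φ : ℝ≥0∞) < criticalFugacity μ) : momentZ μ φ < ⊤ := by
  obtain ⟨r, hφr, hr⟩ := ENNReal.lt_iff_exists_nnreal_btwn.1 h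
  obtain ⟨c, hc0, hc⟩ := FormalMultilinearSeries.norm_mul_pow_le_of_lt_radius _ hr
  have hφr' : φ < r := by exact_mod_cast hφr
  have hr0 : (0 : ℝ) < r := by exact_mod_cast (zero_le.trans_lt hφr')
  have hlt : ‖(φ : ℝ) / r‖ < 1 := by
    rw [Real.norm_of_nonneg (by positivity), div_lt_one hr0]
    exact_mod_cast hφr'
  have hs := (summable_pow_mul_geometric_of_norm_lt_one 1 hlt).mul_right c
  have hs' : Summable fun n : ℕ => (n : ℝ) * (φ : ℝ) ^ n * μ.real {n} := by
    refine Summable.of_nonneg_of_le (fun n => by positivity) (fun n => ?_) hs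
    have h1 := hc n
    rw [FormalMultilinearSeries.ofScalars_norm, Real.norm_of_nonneg measureReal_nonneg] at h1
    calc (n : ℝ) * (φ : ℝ) ^ n * μ.real {n}
        = (n : ℝ) ^ 1 * ((φ : ℝ) / r) ^ n * (μ.real {n} * (r : ℝ) ^ n) := by
          rw [div_pow]; field_simp
      _ ≤ _ := mul_le_mul_of_nonneg_left h1 (by positivity)
  rw [momentZ]
  have e : ∀ n : ℕ, (n : ℝ≥0∞) * (φ : ℝ≥0∞) ^ n * μ {n} =
      ENNReal.ofReal ((n : ℝ) * (φ : ℝ) ^ n * μ.real {n}) := fun n => by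
    rw [ENNReal.ofReal_mul (by positivity), ENNReal.ofReal_mul (by positivity),
      ENNReal.ofReal_pow φ.coe_nonneg, ofReal_measureReal, ENNReal.ofReal_natCast,
      ENNReal.ofReal_coe_nnreal]
  simp_rw [e]
  rw [← ENNReal.ofReal_tsum_of_nonneg (fun n => by positivity) hs']
  exact ENNReal.ofReal_lt_top

lemma partitionZ_ne_zero (h : 0 < φ ∨ μ {0} ≠ 0) : partitionZ μ φ ≠ 0 := by
  intro hZ
  rw [partitionZ, ENNReal.tsum_eq_zero] at hZ
  rcases h with h | h
  · have h0 : ∀ n, μ {n} = 0 := fun n => (mul_eq_zero.1 (hZ n)).resolve_left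
      (pow_ne_zero _ (by exact_mod_cast h.ne'))
    have := (measure_univ (μ := μ))
    rw [← lintegral_one, lintegral_countable'] at this
    simp [h0] at this
  · exact h (by simpa using hZ 0)

end Fugacity

end MMP

/-! ### The main theorem -/

theorem corollary3p5 (d : ℕ)
    (g : ℕ → ℕ → ℕ → ℝ) (hg : MMP.IsRate g)
    (p : MMP.Site d → MMP.Site d → ℝ) (hp : MMP.IsTransition p)
    (a : MMP.Site d → ℝ) (ha : MMP.IsWeight p a)
    (Ω : Set (MMP.Config d)) (P : ℝ≥0 → Kernel (MMP.Config d) (MMP.Config d))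
    (hP : MMP.IsProcess g p Ω P)
    (μ : Measure ℕ) (hμ : IsProbabilityMeasure μ)
    (hinv : MMP.IsInvariant a Ω P (MMP.productMeasure d μ))
    (h : (Ω = MMP.configSpace a ∧ MMP.GeneratedOnLipschitz g p a P ∧ MMP.LinearGrowth g ∧
            ∑' n : ℕ, (n : ℝ≥0∞) * μ {n} < ⊤) ∨
          (MMP.InvarianceByGenerator g p a Ω P ∧ MMP.BoundedRates g)) :
    1 ≤ MMP.criticalFugacity μ ∧
    (∀ φ : ℝ≥0, (φ : ℝ≥0∞) < MMP.criticalFugacity μ → (0 < φ ∨ μ {0} ≠ 0) →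
      MMP.IsInvariant a Ω P (MMP.productMeasure d (MMP.tilt μ φ))) ∧
    (∀ φ : ℝ≥0, (φ : ℝ≥0∞) = MMP.criticalFugacity μ →
      (MMP.momentZ μ φ < ⊤ ∨
        (MMP.partitionZ μ φ < ⊤ ∧ MMP.InvarianceByGenerator g p a Ω P ∧ MMP.BoundedRates g)) →
      MMP.IsInvariant a Ω P (MMP.productMeasure d (MMP.tilt μ φ))) ∧
    MMP.RadZ' μ ⊆ MMP.RadZ μ ∧
    (∀ φ ∈ MMP.RadZ' μ, MMP.IsInvariant a Ω P (MMP.productMeasure d (MMP.tilt μ φ))) ∧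
    (MMP.InvarianceByGenerator g p a Ω P ∧ MMP.BoundedRates g →
      ∀ φ ∈ MMP.RadZ μ, MMP.IsInvariant a Ω P (MMP.productMeasure d (MMP.tilt μ φ))) := by
  have hB : MMP.InvarianceByGenerator g p a Ω P ∧ MMP.BoundedRates g → ∀ φ : ℝ≥0,
      (0 < φ ∨ μ {0} ≠ 0) → MMP.partitionZ μ φ < ⊤ →
      MMP.IsInvariant a Ω P (MMP.productMeasure d (MMP.tilt μ φ)) := by
    rintro ⟨hI, hb⟩ φ h0 hZ
    have := MMP.isProbabilityMeasure_tilt (MMP.partitionZ_ne_zero h0) hZ.ne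
    rw [hI _ inferInstance]
    exact ((hI _ inferInstance).1 hinv).tilt hg (hb.integrable_pairRate hg)
      (hb.integrable_pairRate hg) hp
  have hM : ∀ φ : ℝ≥0, (0 < φ ∨ μ {0} ≠ 0) → MMP.momentZ μ φ < ⊤ →
      MMP.IsInvariant a Ω P (MMP.productMeasure d (MMP.tilt μ φ)) := by
    intro φ h0 hmom
    have hZ := MMP.partitionZ_lt_top_of_momentZ hmom
    rcases h with ⟨rfl, hS, hl, h1⟩ | h
    swap
    · exact hB h φ h0 hZ
    have := MMP.isProbabilityMeasure_tilt (MMP.partitionZ_ne_zero h0) hZ.ne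
    have h1' : ∑' n : ℕ, (n : ℝ≥0∞) * MMP.tilt μ φ {n} < ⊤ := by
      rw [MMP.tsum_mul_tilt]
      exact ENNReal.mul_lt_top (ENNReal.inv_lt_top.2 (pos_iff_ne_zero.2
        (MMP.partitionZ_ne_zero h0))) hmom
    exact ((hinv.annihilatesGenerator hg hp ha hP hS hl h1).tilt hg (hl.integrable_pairRate hg h1)
      (hl.integrable_pairRate hg h1') hp).isInvariant hg hp ha hP hS hl h1'
  -- The critical fugacity is at least `1`, so the requirement `μ {0} ≠ 0` for `φ = 0` never arises
  -- there.
  have hpos : ∀ φ : ℝ≥0, (φ : ℝ≥0∞) = MMP.criticalFugacity μ → 0 < φ := fun φ hφ => by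
    have h1 : (1 : ℝ≥0∞) ≤ φ := hφ ▸ MMP.one_le_criticalFugacity
    exact zero_lt_one.trans_le (by exact_mod_cast h1)
  refine ⟨MMP.one_le_criticalFugacity, fun φ hφ h0 => hM φ h0 (MMP.momentZ_lt_top hφ),
    fun φ hφ hor => ?_, fun φ hφ => ⟨hφ.1, ?_⟩, fun φ hφ => hM φ (Or.inl hφ.1) ?_,
    fun hb φ hφ => hB hb φ (Or.inl hφ.1) ?_⟩
  · rcases hor with hmom | ⟨hZ, hb⟩
    · exact hM φ (Or.inl (hpos φ hφ)) hmom
    · exact hB hb φ (Or.inl (hpos φ hφ)) hZ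
  · exact hφ.2.imp_right fun hc => ⟨hc.1, MMP.partitionZ_lt_top_of_momentZ hc.2⟩
  · exact hφ.2.elim MMP.momentZ_lt_top fun hc => hc.2
  · exact hφ.2.elim (fun hlt => MMP.partitionZ_lt_top_of_momentZ (MMP.momentZ_lt_top hlt))
      fun hc => hc.2
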